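/- Let $(H,\omega)$ be a real symplectic vector space of finite dimension $2n$ (so $\omega$ is a nondegenerate alternating bilinear form on $H$), and let $$\mathit{Sp}^{**}(H) = \{A \in \mathit{Sp}(H) : \pm 1 \notin \mathrm{spec}(A)\}$$ be the set of linear symplectic automorphisms of $H$ not having $1$ or $-1$ as an eigenvalue, with the subspace topology from $\mathrm{End}(H)$. For $A \in \mathit{Sp}^{**}(H)$, let $E \subset H_{\mathbb C} = H \otimes_{\mathbb R} \mathbb C$ be the direct sum of the generalized eigenspaces of $A$ for all eigenvalues $\lambda$ with $|\lambda|^2 = 1$ and $\mathrm{im}(\lambda) > 0$. The Krein index $\kappa(A) \in \mathbb Z$ is the signature (the maximal dimension of a positive definite complex subspace minus the maximal dimension of a negative definite one) of the hermitian form $\langle h_1,h_2\rangle = i\,\omega(\bar h_1,h_2)$ on $E$, where $\omega$ is extended complex bilinearly to $H_{\mathbb C}$. Then $A \mapsto (\mathrm{sign}(\det(I-A)), \kappa(A))$ induces a well-defined map $$\pi_0(\mathit{Sp}^{**}(H)) \longrightarrow \{\pm 1\} \times \mathbb Z$$ on the set of connected components of $\mathit{Sp}^{**}(H)$. This map is injective,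 and its image is exactly the set of pairs $(s,k) \in \{\pm1\} \times \mathbb Z$ such that $|k| \le n$ if $s = 1$, and $|k| \le n-1$ if $s = -1$. -/

import Mathlib

open scoped TensorProduct

noncomputable section

/-- The linear symplectic group `Sp(H)` of a symplectic vector space `(H, ω)`, as a set of linear
endomorphisms: those preserving `ω` (they are invertible since `ω` is nondegenerate and `H` is
finite-dimensional). -/
def Sp {H : Type*} [AddCommGroup H] [Module ℝ H] (ω : LinearMap.BilinForm ℝ H) :
    Set (Module.End ℝ H) :=
  {A | ∀ x y, ω (A x) (A y) = ω x y}

/-- `Sp^{**}(H)`: the symplectic automorphisms which do not have `1` or `-1` as eigenvalues. -/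
def SpStarStar {H : Type*} [AddCommGroup H] [Module ℝ H] (ω : LinearMap.BilinForm ℝ H) : Type _ :=
  {A : Module.End ℝ H // A ∈ Sp ω ∧ (1 : ℝ) ∉ spectrum ℝ A ∧ (-1 : ℝ) ∉ spectrum ℝ A}

/-- The topology of `Sp^{**}(H)` is the subspace topology from `End(H)`, where the real vector space
`End(H)` has its module topology. When `H` is finite-dimensional, this is the usual (unique
Hausdorff vector space) topology of `End(H)`. -/
instance {H : Type*} [AddCommGroup H] [Module ℝ H] (ω : LinearMap.BilinForm ℝ H) :
    TopologicalSpace (SpStarStar ω) :=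
  TopologicalSpace.induced (fun A => A.1) (moduleTopology ℝ (Module.End ℝ H))

/-- Complex conjugation `h ↦ h̄` on the complexification `H_ℂ = ℂ ⊗ H`. -/
def conjC (H : Type*) [AddCommGroup H] [Module ℝ H] : ℂ ⊗[ℝ] H →ₗ[ℝ] ℂ ⊗[ℝ] H :=
  LinearMap.rTensor H Complex.conjAe.toLinearMap

/-- The hermitian form `⟨h₁, h₂⟩ = i ω(h̄₁, h₂)` on `H_ℂ`, where `ω` is extended complex
bilinearly. -/
def kreinForm {H : Type*} [AddCommGroup H] [Module ℝ H] (ω : LinearMap.BilinForm ℝ H)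
    (h₁ h₂ : ℂ ⊗[ℝ] H) : ℂ :=
  Complex.I * (LinearMap.BilinForm.baseChange ℂ ω) (conjC H h₁) h₂

/-- The sum `E ⊆ H_ℂ` of all generalized eigenspaces of `A` for the eigenvalues `z` with
`|z|² = 1` and `im z > 0`. -/
def kreinSpace {H : Type*} [AddCommGroup H] [Module ℝ H] (A : Module.End ℝ H) :
    Submodule ℂ (ℂ ⊗[ℝ] H) :=
  ⨆ z ∈ {z : ℂ | ‖z‖ ^ 2 = 1 ∧ 0 < z.im},
    Module.End.maxGenEigenspace (LinearMap.baseChange ℂ A : Module.End ℂ (ℂ ⊗[ℝ] H)) z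

/-- The positive index of inertia on the complex subspace `E` of a hermitian form `b`: the largest
dimension of a complex subspace of `E` on which `b` is positive definite. -/
def posInertia {V : Type*} [AddCommGroup V] [Module ℂ V] (E : Submodule ℂ V) (b : V → V → ℂ) : ℕ :=
  sSup {d | ∃ W : Submodule ℂ V, W ≤ E ∧ Module.finrank ℂ W = d ∧
    ∀ h ∈ W, h ≠ 0 → 0 < (b h h).re}

/-- The Krein index `κ(A)`: the signature (positive minus negative index of inertia) of the
hermitian form `i ω(h̄₁, h₂)` on `E`. -/
def kreinIndex {H : Type*} [AddCommGroup H] [Module ℝ H] (ω : LinearMap.BilinForm ℝ H)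
    (A : Module.End ℝ H) : ℤ :=
  (posInertia (kreinSpace A) (kreinForm ω) : ℤ) -
    (posInertia (kreinSpace A) (fun h₁ h₂ => -kreinForm ω h₁ h₂) : ℤ)

end

/-! The Cayley transform `X ↦ -(1 + X)(1 - X)⁻¹` is an involution that exchanges `SpStarStar ω` with
the set `cayleyDomain ω` of infinitesimally symplectic `X` for which `X` and `1 - X` are injective.
For `A = cayley X` one has `(1 - A)(1 - X) = 2`, so `det (1 - A)` and `det (1 - X)` have the same
sign.

The Krein index becomes half the signature of `ω(X x, x)`. By `two_mul_kreinIndex`, `2 κ(A)` is the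
signature of the hermitian extension of `ω(x, A y) - ω(A x, y)`: on `E` this form deforms to `i
ω(x̄, y)` through nondegenerate forms, conjugation doubles the contribution of `E`, and the
eigenvalues off the unit circle contribute zero. The substitution `x = (u - X u)/2` turns this form
into `ω(X u, u)`. Both invariants are therefore locally constant, and if `p` is the positive index
of `ω(X x, x)`, then `κ = p - n`.

For injectivity, `p` and the sign of `det (1 - X)` must determine the path component of `X`. Without
the condition on `1 - X`, the index `p` alone suffices (`joinedIn_skewReg`): congruent forms are
joined by moving the change of basis inside `GL`. If `X` has no real eigenvalue `≥ 1`, it can be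
scaled towards `0`, where `1 - X` stays invertible for free. A real eigenvalue `> 1` splits off a
hyperbolic plane and flips the sign of the determinant on the rest. When `det (1 - X) > 0` such
planes therefore occur in pairs, and a pair can pass the eigenvalue `1` together through nonreal
eigenvalues (`joinedIn_hypSum_hypSum`). When `det (1 - X) < 0`, one plane is split off, in a
position normalized by symplectic transvections, and the positive case applies to the rest.

For the image, `p` ranges over `0, ..., 2n` when the determinant is positive. A negative determinant
forces an isotropic eigenvector, hence `1 ≤ p ≤ 2n - 1`, and adding a hyperbolic plane realizes all
these values. -/

open scoped TensorProduct ComplexConjugate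
open Module Filter Topology

/-! ### Inertia of hermitian forms and its local constancy -/

section HermitianInertia

variable {V : Type*} [AddCommGroup V] [Module ℂ V]

/-- A subspace of `E` on which `b` is positive and a complementary one on which it is nonpositive
compute the positive index of inertia. -/
theorem posInertia_eq_finrank {E P N : Submodule ℂ V} [FiniteDimensional ℂ E] {b : V → V → ℂ}
    (hPE : P ≤ E) (hNE : N ≤ E) (hP : ∀ x ∈ P, x ≠ 0 → 0 < (b x x).re)
    (hN : ∀ x ∈ N, (b x x).re ≤ 0) (hPN : finrank ℂ E ≤ finrank ℂ P + finrank ℂ N) :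
    posInertia E b = finrank ℂ P := by
  refine IsGreatest.csSup_eq ⟨⟨P, hPE, rfl, hP⟩, ?_⟩
  rintro _ ⟨W, hWE, rfl, hW⟩
  have : FiniteDimensional ℂ W := Submodule.finiteDimensional_of_le hWE
  have : FiniteDimensional ℂ N := Submodule.finiteDimensional_of_le hNE
  have hdisj : Disjoint W N := by
    rw [Submodule.disjoint_def]
    intro x hxW hxN
    by_contra hx
    exact (hW x hxW hx).not_ge (hN x hxN)
  have h1 := Submodule.finrank_sup_add_finrank_inf_eq W N
  rw [hdisj.eq_bot, finrank_bot] at h1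
  have h2 : finrank ℂ (W ⊔ N : Submodule ℂ V) ≤ finrank ℂ E :=
    Submodule.finrank_mono (sup_le hWE hNE)
  omega

variable {b : V →ₗ⋆[ℂ] V →ₗ[ℂ] ℂ}

/-- A vector isotropic for a nonpositive hermitian form is in its radical. -/
theorem apply_eq_zero_of_nonpos (hb : ∀ x y, conj (b x y) = b y x) {N : Submodule ℂ V}
    (hN : ∀ x ∈ N, (b x x).re ≤ 0) {x y : V} (hx : x ∈ N) (hy : y ∈ N) (hxx : (b x x).re = 0) :
    b x y = 0 := by
  by_contra hne
  set z := b x y with hz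
  have hzpos : 0 < Complex.normSq z := Complex.normSq_pos.2 hne
  -- Since `x` is isotropic, the form at `t z x + y` is affine in `t` with slope `2 |z|²`, so it
  -- cannot stay nonpositive unless `z = 0`.
  have key : ∀ t : ℝ, 2 * t * Complex.normSq z + (b y y).re ≤ 0 := by
    intro t
    have := hN (((t : ℂ) * z) • x + y) (N.add_mem (N.smul_mem _ hx) hy)
    have hyx : b y x = conj z := by rw [hz, hb]
    simp only [map_add, map_smulₛₗ, LinearMap.add_apply, LinearMap.smul_apply,
      smul_eq_mul, hyx, ← hz, map_mul, Complex.conj_ofReal, RingHom.id_apply, Complex.add_re] at this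
    have e1 : (↑t * conj z * z).re = t * Complex.normSq z := by
      rw [mul_assoc, mul_comm (conj z), Complex.mul_conj]; norm_cast
    have e2 : (↑t * z * conj z).re = t * Complex.normSq z := by
      rw [mul_assoc, Complex.mul_conj]; norm_cast
    have e3 : (↑t * z * (↑t * conj z * (b x x))).re = 0 := by
      have : ↑t * z * (↑t * conj z * (b x x)) = ((t * t * Complex.normSq z : ℝ) : ℂ) * b x x := by
        push_cast [← Complex.mul_conj]; ring
      rw [this, Complex.re_ofReal_mul, hxx, mul_zero]
    rw [mul_add, Complex.add_re] at this
    linarith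
  have h1 := key ((1 - (b y y).re) / (2 * Complex.normSq z))
  have : 2 * ((1 - (b y y).re) / (2 * Complex.normSq z)) * Complex.normSq z = 1 - (b y y).re := by
    field_simp
  linarith

/-- The orthogonal complement of `P` in `E` is cut out by `finrank ℂ P` linear equations, one for
each basis vector; nondegeneracy plays no role. -/
theorem finrank_le_finrank_add_finrank_orthogonal (b : V →ₗ⋆[ℂ] V →ₗ[ℂ] ℂ) (E P : Submodule ℂ V)
    [FiniteDimensional ℂ E] [FiniteDimensional ℂ P] :
    ∃ N ≤ E, (∀ x ∈ N, ∀ y ∈ P, b y x = 0) ∧ (∀ x ∈ E, (∀ y ∈ P, b y x = 0) → x ∈ N) ∧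
      finrank ℂ E ≤ finrank ℂ P + finrank ℂ N := by
  let B := finBasis ℂ P
  let f : E →ₗ[ℂ] (Fin (finrank ℂ P) → ℂ) :=
    LinearMap.pi fun i => (b (B i : V)).comp E.subtype
  have hspan : ∀ x : V, (∀ i, b (B i : V) x = 0) → ∀ y ∈ P, b y x = 0 := by
    intro x hx y hy
    have := B.sum_repr ⟨y, hy⟩
    have h2 : y = ∑ i, B.repr ⟨y, hy⟩ i • (B i : V) := by
      simpa only [Submodule.coe_sum, Submodule.coe_smul] using (congrArg Subtype.val this).symm
    rw [h2]
    simp [hx]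
  refine ⟨(LinearMap.ker f).map E.subtype, Submodule.map_subtype_le _ _, ?_, ?_, ?_⟩
  · rintro x ⟨x', hx', rfl⟩
    exact hspan _ fun i => congrFun (LinearMap.mem_ker.1 hx') i
  · intro x hx h
    refine ⟨⟨x, hx⟩, LinearMap.mem_ker.2 (funext fun i => ?_), rfl⟩
    exact h _ (B i).2
  · have h1 := f.finrank_range_add_finrank_ker
    have h2 : finrank ℂ (LinearMap.range f) ≤ finrank ℂ P := by
      simpa using (LinearMap.range f).finrank_le
    rw [Submodule.finrank_map_subtype_eq]
    omega

/-- A hermitian form which is nondegenerate on `E` splits `E` into a positive definite and a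
negative definite part. -/
theorem exists_posDef_negDef_decomposition (hb : ∀ x y, conj (b x y) = b y x) (E : Submodule ℂ V)
    [FiniteDimensional ℂ E] (hnd : ∀ x ∈ E, (∀ y ∈ E, b x y = 0) → x = 0) :
    ∃ P ≤ E, ∃ N ≤ E, (∀ x ∈ P, x ≠ 0 → 0 < (b x x).re) ∧ (∀ x ∈ N, x ≠ 0 → (b x x).re < 0) ∧
      finrank ℂ P + finrank ℂ N = finrank ℂ E := by
  classical
  let S : Set ℕ := {d | ∃ W : Submodule ℂ V, W ≤ E ∧ finrank ℂ W = d ∧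
    ∀ h ∈ W, h ≠ 0 → 0 < (b h h).re}
  have hne : S.Nonempty := ⟨0, ⊥, bot_le, finrank_bot _ _, fun x hx h => (h (by simpa using hx)).elim⟩
  have hbdd : BddAbove S := ⟨finrank ℂ E, by
    rintro _ ⟨W, hW, rfl, -⟩
    exact Submodule.finrank_mono hW⟩
  obtain ⟨P, hPE, hPd, hP⟩ := Nat.sSup_mem hne hbdd
  have hmax : ∀ W ≤ E, (∀ h ∈ W, h ≠ 0 → 0 < (b h h).re) → finrank ℂ W ≤ finrank ℂ P := by
    intro W hW h
    rw [hPd]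
    exact le_csSup hbdd ⟨W, hW, rfl, h⟩
  have : FiniteDimensional ℂ P := Submodule.finiteDimensional_of_le hPE
  obtain ⟨N, hNE, hNP, hNmem, hdim⟩ := finrank_le_finrank_add_finrank_orthogonal b E P
  have : FiniteDimensional ℂ N := Submodule.finiteDimensional_of_le hNE
  have hPN : ∀ x ∈ P, ∀ y ∈ N, b x y = 0 ∧ b y x = 0 := fun x hx y hy =>
    ⟨hNP y hy x hx, by rw [← hb, hNP y hy x hx, map_zero]⟩
  have hdisj : Disjoint P N := by
    rw [Submodule.disjoint_def]
    intro x hx hx'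
    by_contra h0
    have := hP x hx h0
    rw [(hPN x hx x hx').1] at this
    simp at this
  have hsup : P ⊔ N = E := by
    refine Submodule.eq_of_le_of_finrank_le (sup_le hPE hNE) ?_
    have h1 := Submodule.finrank_sup_add_finrank_inf_eq P N
    rw [hdisj.eq_bot, finrank_bot] at h1
    omega
  -- A positive vector orthogonal to `P` would enlarge `P`, which has maximal dimension.
  have hnonpos : ∀ x ∈ N, (b x x).re ≤ 0 := by
    intro x hx
    by_contra! hpos
    have hx0 : x ≠ 0 := by rintro rfl; simp at hpos
    have hxP : x ∉ P := fun h => hx0 (Submodule.disjoint_def.1 hdisj x h hx)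
    have hW : ∀ h ∈ P ⊔ Submodule.span ℂ {x}, h ≠ 0 → 0 < (b h h).re := by
      intro h hh h0
      obtain ⟨p, hp, y, hy, rfl⟩ := Submodule.mem_sup.1 hh
      obtain ⟨c, rfl⟩ := Submodule.mem_span_singleton.1 hy
      have e : (b (p + c • x) (p + c • x)).re = (b p p).re + Complex.normSq c * (b x x).re := by
        simp only [map_add, map_smulₛₗ, LinearMap.add_apply, LinearMap.smul_apply,
          (hPN p hp x hx).1, (hPN p hp x hx).2, smul_eq_mul, mul_zero, RingHom.id_apply, add_zero,
          zero_add, Complex.add_re]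
        congr 1
        rw [← mul_assoc, Complex.mul_conj, Complex.re_ofReal_mul]
      rw [e]
      by_cases hp0 : p = 0
      · have hc : c ≠ 0 := by rintro rfl; simp [hp0] at h0
        rw [hp0]; simp only [map_zero, Complex.zero_re, zero_add]
        exact mul_pos (Complex.normSq_pos.2 hc) hpos
      · exact add_pos_of_pos_of_nonneg (hP p hp hp0) (mul_nonneg (Complex.normSq_nonneg _) hpos.le)
    have hle := hmax _ (sup_le hPE ((Submodule.span_singleton_le_iff_mem _ _).2 (hNE hx))) hW
    have hlt : P < P ⊔ Submodule.span ℂ {x} := by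
      refine lt_of_le_of_ne le_sup_left fun h => hxP ?_
      rw [h]
      exact Submodule.mem_sup_right (Submodule.mem_span_singleton_self x)
    exact (Submodule.finrank_lt_finrank_of_lt hlt).not_ge hle
  refine ⟨P, hPE, N, hNE, hP, fun x hx hx0 => lt_of_le_of_ne (hnonpos x hx) fun h0 => hx0 ?_, ?_⟩
  -- An isotropic vector of `N` is orthogonal to `N` by semidefiniteness and to `P` by construction,
  -- so it lies in the radical on `E`.
  · refine hnd x (hNE hx) fun y hy => ?_
    rw [← hsup] at hy
    obtain ⟨p, hp, z, hz, rfl⟩ := Submodule.mem_sup.1 hy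
    rw [map_add, (hPN p hp x hx).2, apply_eq_zero_of_nonpos hb hnonpos hx hz h0, add_zero]
  · have h1 := Submodule.finrank_sup_add_finrank_inf_eq P N
    rw [hdisj.eq_bot, finrank_bot, hsup] at h1
    omega

/-- Positivity on the compact unit sphere of coordinates survives small changes of `t` uniformly;
homogeneity extends it to all of `W`. -/
theorem eventually_posDef {T : Type*} [TopologicalSpace T] {b : T → V →ₗ⋆[ℂ] V →ₗ[ℂ] ℂ}
    (hc : ∀ x y, Continuous fun t => b t x y) (W : Submodule ℂ V) [FiniteDimensional ℂ W] (t₀ : T)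
    (hW : ∀ x ∈ W, x ≠ 0 → 0 < (b t₀ x x).re) :
    ∀ᶠ t in 𝓝 t₀, ∀ x ∈ W, x ≠ 0 → 0 < (b t x x).re := by
  let B := finBasis ℂ W
  let v : (Fin (finrank ℂ W) → ℂ) → V := fun c => ∑ i, c i • (B i : V)
  have hv : ∀ c, v c = ((B.equivFun.symm c : W) : V) := fun c => by
    simp [v, Basis.equivFun_symm_apply]
  have hexp : ∀ t c, b t (v c) (v c) = ∑ i, ∑ j, conj (c i) * (c j * b t (B i : V) (B j : V)) := by
    intro t c
    simp only [v, map_sum, map_smulₛₗ, LinearMap.sum_apply, LinearMap.smul_apply,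
      smul_eq_mul, RingHom.id_apply, Finset.mul_sum]
    rw [Finset.sum_comm]
    refine Finset.sum_congr rfl fun i _ => Finset.sum_congr rfl fun j _ => by ring
  have hcont : Continuous fun p : T × (Fin (finrank ℂ W) → ℂ) => (b p.1 (v p.2) (v p.2)).re := by
    simp only [hexp]
    refine Complex.continuous_re.comp ?_
    refine continuous_finsetSum _ fun i _ => continuous_finsetSum _ fun j _ => ?_
    have := (hc (B i : V) (B j : V)).comp (continuous_fst (X := T) (Y := Fin (finrank ℂ W) → ℂ))
    have h2 : Continuous fun p : T × (Fin (finrank ℂ W) → ℂ) => conj (p.2 i) :=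
      Complex.continuous_conj.comp ((continuous_apply i).comp continuous_snd)
    exact h2.mul (((continuous_apply j).comp continuous_snd).mul this)
  have hK : IsCompact (Metric.sphere (0 : Fin (finrank ℂ W) → ℂ) 1) := isCompact_sphere _ _
  have hev := hK.eventually_forall_of_forall_eventually (x₀ := t₀)
    (P := fun t c => 0 < (b t (v c) (v c)).re) (by
      intro c hcs
      have hpos : 0 < (b t₀ (v c) (v c)).re := by
        refine hW _ (by rw [hv]; exact Submodule.coe_mem _) ?_
        rw [hv]
        simp only [ne_eq, ZeroMemClass.coe_eq_zero, EmbeddingLike.map_eq_zero_iff]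
        rintro rfl
        simp at hcs
      exact hcont.continuousAt.eventually (lt_mem_nhds (a := (0 : ℝ)) hpos))
  filter_upwards [hev] with t ht x hx hx0
  set c := B.equivFun ⟨x, hx⟩ with hcdef
  have hc0 : c ≠ 0 := by
    simpa [hcdef] using hx0
  have hn : 0 < ‖c‖ := norm_pos_iff.2 hc0
  have hxv : x = (‖c‖ : ℂ) • v ((‖c‖ : ℂ)⁻¹ • c) := by
    rw [hv, map_smul, Submodule.coe_smul, smul_smul,
      mul_inv_cancel₀ (by exact_mod_cast hn.ne'), one_smul, hcdef]
    simp
  have := ht ((‖c‖ : ℂ)⁻¹ • c) (by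
    rw [mem_sphere_zero_iff_norm, norm_smul]; simp [hn.ne'])
  rw [hxv]
  simp only [map_smulₛₗ, LinearMap.smul_apply, smul_eq_mul, Complex.conj_ofReal,
    RingHom.id_apply, Complex.re_ofReal_mul] at this ⊢
  positivity

/-- The positive index of inertia is locally constant in continuous families of nondegenerate
hermitian forms. -/
theorem isLocallyConstant_posInertia {T : Type*} [TopologicalSpace T]
    {b : T → V →ₗ⋆[ℂ] V →ₗ[ℂ] ℂ} (hb : ∀ t x y, conj (b t x y) = b t y x)
    (hc : ∀ x y, Continuous fun t => b t x y) (E : Submodule ℂ V) [FiniteDimensional ℂ E]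
    (hnd : ∀ t, ∀ x ∈ E, (∀ y ∈ E, b t x y = 0) → x = 0) :
    IsLocallyConstant fun t => posInertia E fun x y => b t x y := by
  rw [IsLocallyConstant.iff_eventually_eq]
  intro t₀
  obtain ⟨P, hPE, N, hNE, hP, hN, hdim⟩ := exists_posDef_negDef_decomposition (hb t₀) E (hnd t₀)
  have : FiniteDimensional ℂ P := Submodule.finiteDimensional_of_le hPE
  have : FiniteDimensional ℂ N := Submodule.finiteDimensional_of_le hNE
  -- Both definite subspaces at `t₀` stay definite nearby; as their dimensions add up to that of
  -- `E`, they still compute the index.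
  have h1 := eventually_posDef hc P t₀ hP
  have h2 := eventually_posDef (b := fun t => -b t) (fun x y => (hc x y).neg) N t₀
    (fun x hx h => by simpa using hN x hx h)
  have key : ∀ t, (∀ x ∈ P, x ≠ 0 → 0 < (b t x x).re) →
      (∀ x ∈ N, x ≠ 0 → 0 < ((-b t) x x).re) →
      posInertia E (fun x y => b t x y) = finrank ℂ P := by
    intro t hP hN
    refine posInertia_eq_finrank hPE hNE hP (fun x hx => ?_) hdim.ge
    by_cases h0 : x = 0
    · simp [h0]
    · have := hN x hx h0
      simp only [LinearMap.neg_apply, Complex.neg_re] at this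
      linarith
  filter_upwards [h1, h2] with t ht1 ht2
  rw [key t ht1 ht2, key t₀ hP fun x hx h => by simpa using hN x hx h]

end HermitianInertia

/-! ### Sums of generalized eigenspaces -/

section SpectralSum

variable {V : Type*} [AddCommGroup V] [Module ℂ V]

/-- The sum of the generalized eigenspaces of `f` for the eigenvalues in `s`. -/
def spectralSum (f : End ℂ V) (s : Set ℂ) : Submodule ℂ V :=
  ⨆ z ∈ s, f.maxGenEigenspace z

theorem spectralSum_le {f : End ℂ V} {s : Set ℂ} {W : Submodule ℂ V}
    (h : ∀ z ∈ s, f.maxGenEigenspace z ≤ W) : spectralSum f s ≤ W :=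
  iSup₂_le h

theorem maxGenEigenspace_le_spectralSum (f : End ℂ V) {s : Set ℂ} {z : ℂ} (hz : z ∈ s) :
    f.maxGenEigenspace z ≤ spectralSum f s :=
  le_iSup₂_of_le z hz le_rfl

theorem apply_mem_spectralSum {f : End ℂ V} {s : Set ℂ} {x : V} (hx : x ∈ spectralSum f s) :
    f x ∈ spectralSum f s := by
  suffices h : spectralSum f s ≤ (spectralSum f s).comap f from h hx
  exact spectralSum_le fun z hz y hy => maxGenEigenspace_le_spectralSum f hz
    (Module.End.mapsTo_maxGenEigenspace_of_comm (Commute.refl f) z hy)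

theorem disjoint_spectralSum (f : End ℂ V) {s t : Set ℂ} (hst : Disjoint s t) :
    Disjoint (spectralSum f s) (spectralSum f t) :=
  f.independent_maxGenEigenspace.disjoint_biSup_biSup hst

theorem mem_of_eigenvector_mem_spectralSum {f : End ℂ V} {s : Set ℂ} {x : V} {z : ℂ}
    (hx : x ∈ spectralSum f s) (hx0 : x ≠ 0) (hfx : f x = z • x) : z ∈ s := by
  by_contra hz
  have h1 : x ∈ spectralSum f {z} := maxGenEigenspace_le_spectralSum f (Set.mem_singleton z)
    (Module.End.eigenspace_le_maxGenEigenspace (Module.End.mem_eigenspace_iff.2 hfx))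
  exact hx0 (Submodule.disjoint_def.1
    (disjoint_spectralSum f (Set.disjoint_singleton_right.2 hz)) x hx h1)

/-- Induction on the sum of the nilpotency orders: writing `f x = z x + x'` and `f y = w y + y'`,
all terms with `x'` or `y'` vanish, and invariance leaves `(z w - 1) B(x, y) = 0`. -/
theorem apply_eq_zero_of_mem_maxGenEigenspace {f : End ℂ V} {B : LinearMap.BilinForm ℂ V}
    (hB : ∀ x y, B (f x) (f y) = B x y) {z w : ℂ} (hzw : z * w ≠ 1) {x y : V}
    (hx : x ∈ f.maxGenEigenspace z) (hy : y ∈ f.maxGenEigenspace w) : B x y = 0 := by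
  obtain ⟨k, hk⟩ := (Module.End.mem_maxGenEigenspace f z x).1 hx
  obtain ⟨l, hl⟩ := (Module.End.mem_maxGenEigenspace f w y).1 hy
  clear hx hy
  have key : ∀ m k l : ℕ, k + l ≤ m → ∀ x y : V, ((f - z • (1 : End ℂ V)) ^ k) x = 0 →
      ((f - w • (1 : End ℂ V)) ^ l) y = 0 → B x y = 0 := by
    intro m
    induction m with
    | zero =>
      intro k l hkl x y hx hy
      obtain rfl : k = 0 := by omega
      have : x = 0 := by simpa using hx
      simp [this]
    | succ m ih =>
      intro k l hkl x y hx hy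
      rcases k with _ | k
      · have : x = 0 := by simpa using hx
        simp [this]
      rcases l with _ | l
      · have : y = 0 := by simpa using hy
        simp [this]
      set x' := (f - z • (1 : End ℂ V)) x with hx'
      set y' := (f - w • (1 : End ℂ V)) y with hy'
      have hx1 : ((f - z • (1 : End ℂ V)) ^ k) x' = 0 := by
        rw [hx', ← Module.End.mul_apply, ← pow_succ]; exact hx
      have hy1 : ((f - w • (1 : End ℂ V)) ^ l) y' = 0 := by
        rw [hy', ← Module.End.mul_apply, ← pow_succ]; exact hy
      have e1 : B x' y = 0 := ih k (l + 1) (by omega) x' y hx1 hy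
      have e2 : B x y' = 0 := ih (k + 1) l (by omega) x y' hx hy1
      have e3 : B x' y' = 0 := ih k l (by omega) x' y' hx1 hy1
      have hfx : f x = z • x + x' := by simp [hx']
      have hfy : f y = w • y + y' := by simp [hy']
      have h := hB x y
      rw [hfx, hfy] at h
      simp only [map_add, map_smul, LinearMap.add_apply, LinearMap.smul_apply, smul_eq_mul, e1, e2,
        e3, mul_zero, add_zero] at h
      have h' : (z * w - 1) * B x y = 0 := by linear_combination h
      exact (mul_eq_zero.1 h').resolve_left (sub_ne_zero.2 hzw)
  exact key (k + l) k l le_rfl x y hk hl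

theorem apply_eq_zero_of_mem_spectralSum {f : End ℂ V} {B : LinearMap.BilinForm ℂ V}
    (hB : ∀ x y, B (f x) (f y) = B x y) {s t : Set ℂ} (hst : ∀ z ∈ s, ∀ w ∈ t, z * w ≠ 1) {x y : V}
    (hx : x ∈ spectralSum f s) (hy : y ∈ spectralSum f t) : B x y = 0 := by
  suffices h : spectralSum f s ≤ LinearMap.ker (B.flip y) from h hx
  refine spectralSum_le fun z hz x hx => ?_
  suffices h : spectralSum f t ≤ LinearMap.ker (B x) from h hy
  refine spectralSum_le fun w hw y hy => ?_
  exact apply_eq_zero_of_mem_maxGenEigenspace hB (hst z hz w hw) hx hy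

/-- The kernel of the quadratic polynomial in `f` meets the spectral sum in an invariant subspace;
an eigenvector there would have a root in `s` as eigenvalue. The radicals of the forms below are
described by such equations. -/
theorem eq_zero_of_quadratic_of_mem_spectralSum [FiniteDimensional ℂ V] {f : End ℂ V} {s : Set ℂ}
    {a b c : ℂ} (h : ∀ z ∈ s, a * z ^ 2 + b * z + c ≠ 0) {x : V} (hx : x ∈ spectralSum f s)
    (hfx : a • f (f x) + b • f x + c • x = 0) : x = 0 := by
  let q : End ℂ V := a • (f * f) + b • f + c • 1
  let U : Submodule ℂ V := spectralSum f s ⊓ LinearMap.ker q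
  have hq : ∀ y, q y = a • f (f y) + b • f y + c • y := fun y => by simp [q]
  have hU : ∀ y ∈ U, f y ∈ U := by
    rintro y ⟨hy1, hy2⟩
    refine ⟨apply_mem_spectralSum hy1, ?_⟩
    have : q y = 0 := hy2
    have h2 := congrArg f this
    change q (f y) = 0
    rw [hq] at h2 ⊢
    simpa using h2
  by_contra hx0
  have hxU : x ∈ U := ⟨hx, by change q x = 0; rw [hq, hfx]⟩
  have : Nontrivial U := ⟨⟨x, hxU⟩, 0, fun h => hx0 (congrArg Subtype.val h)⟩
  obtain ⟨z, hz⟩ := Module.End.exists_eigenvalue (f.restrict hU)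
  obtain ⟨u, hu⟩ := hz.exists_hasEigenvector
  have hu0 : (u : V) ≠ 0 := fun h => hu.2 (Subtype.ext h)
  have hfu : f u = z • (u : V) := congrArg Subtype.val hu.apply_eq_smul
  have hzs := mem_of_eigenvector_mem_spectralSum u.2.1 hu0 hfu
  have hqu : q u = 0 := u.2.2
  rw [hq, hfu, map_smul, hfu] at hqu
  have : (a * z ^ 2 + b * z + c) • (u : V) = 0 := by
    rw [← hqu]; module
  exact h z hzs ((smul_eq_zero.1 this).resolve_right hu0)

end SpectralSum

/-! ### Complexification, conjugation and sesquilinear extensions -/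

section Complexification

variable {H : Type*} [AddCommGroup H] [Module ℝ H]

@[simp]
theorem conjC_tmul (z : ℂ) (x : H) : conjC H (z ⊗ₜ[ℝ] x) = conj z ⊗ₜ[ℝ] x := by
  simp [conjC]

theorem conjC_smul (z : ℂ) (x : ℂ ⊗[ℝ] H) : conjC H (z • x) = conj z • conjC H x := by
  induction x with
  | zero => simp
  | tmul w x => simp [TensorProduct.smul_tmul']
  | add x y hx hy => rw [smul_add, map_add, map_add, smul_add, hx, hy]

@[simp]
theorem conjC_conjC (x : ℂ ⊗[ℝ] H) : conjC H (conjC H x) = x := by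
  induction x with
  | zero => simp
  | tmul w x => simp
  | add x y hx hy => rw [map_add, map_add, hx, hy]

theorem conjC_baseChange (A : End ℝ H) (x : ℂ ⊗[ℝ] H) :
    conjC H (A.baseChange ℂ x) = A.baseChange ℂ (conjC H x) := by
  induction x with
  | zero => simp
  | tmul w x => simp
  | add x y hx hy => simp only [map_add, hx, hy]

theorem baseChange_conjC (B : LinearMap.BilinForm ℝ H) (x y : ℂ ⊗[ℝ] H) :
    B.baseChange ℂ (conjC H x) (conjC H y) = conj (B.baseChange ℂ x y) := by
  induction x with
  | zero => simp
  | tmul z x =>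
    induction y with
    | zero => simp
    | tmul w y => simp [LinearMap.BilinForm.baseChange_tmul]
    | add x y hx hy => simp only [map_add, hx, hy]
  | add x y hx hy => simp only [map_add, LinearMap.add_apply, hx, hy]

/-- Complex conjugation on the complexification, as a semilinear map. -/
noncomputable def conjCₛₗ (H : Type*) [AddCommGroup H] [Module ℝ H] : ℂ ⊗[ℝ] H →ₗ⋆[ℂ] ℂ ⊗[ℝ] H where
  toFun := conjC H
  map_add' := map_add _
  map_smul' := conjC_smul

@[simp]
theorem conjCₛₗ_apply (x : ℂ ⊗[ℝ] H) : conjCₛₗ H x = conjC H x := rfl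

/-- The sesquilinear extension of a real bilinear form to the complexification. -/
noncomputable def sesqExt (B : LinearMap.BilinForm ℝ H) : ℂ ⊗[ℝ] H →ₗ⋆[ℂ] ℂ ⊗[ℝ] H →ₗ[ℂ] ℂ :=
  LinearMap.comp (B.baseChange ℂ) (conjCₛₗ H)

@[simp]
theorem sesqExt_apply (B : LinearMap.BilinForm ℝ H) (x y : ℂ ⊗[ℝ] H) :
    sesqExt B x y = B.baseChange ℂ (conjC H x) y := rfl

/-- The constant `c` covers symmetric forms (`c = 1`) and alternating forms (`c = -1`) at once. -/
theorem baseChange_swap {B : LinearMap.BilinForm ℝ H} {c : ℝ} (hB : ∀ x y, B x y = c * B y x)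
    (x y : ℂ ⊗[ℝ] H) : B.baseChange ℂ x y = c * B.baseChange ℂ y x := by
  induction x with
  | zero => simp
  | tmul z x =>
    induction y with
    | zero => simp
    | tmul w y =>
      simp only [LinearMap.BilinForm.baseChange_tmul, hB x y]
      simp [mul_comm, mul_left_comm]
    | add x y hx hy => simp only [map_add, LinearMap.add_apply, hx, hy, mul_add]
  | add x y hx hy => simp only [map_add, LinearMap.add_apply, hx, hy, mul_add]

theorem conj_sesqExt {B : LinearMap.BilinForm ℝ H} {c : ℝ} (hB : ∀ x y, B x y = c * B y x)
    (x y : ℂ ⊗[ℝ] H) : conj (sesqExt B x y) = c * sesqExt B y x := by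
  rw [sesqExt_apply, sesqExt_apply, ← baseChange_conjC, conjC_conjC, baseChange_swap hB]

theorem exists_eq_tmul_add_tmul (P : Submodule ℝ H) {x : ℂ ⊗[ℝ] H} (hx : x ∈ P.baseChange ℂ) :
    ∃ a ∈ P, ∃ b ∈ P, x = 1 ⊗ₜ[ℝ] a + Complex.I ⊗ₜ[ℝ] b := by
  obtain ⟨y, rfl⟩ := hx
  induction y with
  | zero => exact ⟨0, zero_mem _, 0, zero_mem _, by simp⟩
  | tmul z a =>
    refine ⟨z.re • (a : H), P.smul_mem _ a.2, z.im • (a : H), P.smul_mem _ a.2, ?_⟩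
    rw [LinearMap.baseChange_tmul, ← TensorProduct.smul_tmul, ← TensorProduct.smul_tmul,
      ← TensorProduct.add_tmul]
    congr 1
    apply Complex.ext <;> simp
  | add x y hx hy =>
    obtain ⟨a, ha, b, hb, h⟩ := hx
    obtain ⟨a', ha', b', hb', h'⟩ := hy
    refine ⟨a + a', add_mem ha ha', b + b', add_mem hb hb', ?_⟩
    rw [map_add, h, h', TensorProduct.tmul_add, TensorProduct.tmul_add]
    abel

theorem sesqExt_self_re (B : LinearMap.BilinForm ℝ H) (a b : H) :
    (sesqExt B (1 ⊗ₜ[ℝ] a + Complex.I ⊗ₜ[ℝ] b) (1 ⊗ₜ[ℝ] a + Complex.I ⊗ₜ[ℝ] b)).re =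
      B a a + B b b := by
  simp [LinearMap.BilinForm.baseChange_tmul]

theorem finrank_submodule_baseChange (P : Submodule ℝ H) :
    finrank ℂ (P.baseChange ℂ) = finrank ℝ P := by
  have hinj : Function.Injective (P.subtype.baseChange ℂ) :=
    Module.Flat.lTensor_preserves_injective_linearMap (M := ℂ) P.subtype P.injective_subtype
  rw [Submodule.baseChange, LinearMap.finrank_range_of_inj hinj, finrank_baseChange]

theorem sesqExt_posDef {B : LinearMap.BilinForm ℝ H} {P : Submodule ℝ H}
    (hP : ∀ x ∈ P, x ≠ 0 → 0 < B x x) {x : ℂ ⊗[ℝ] H} (hx : x ∈ P.baseChange ℂ) (hx0 : x ≠ 0) :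
    0 < (sesqExt B x x).re := by
  obtain ⟨a, ha, b, hb, rfl⟩ := exists_eq_tmul_add_tmul P hx
  have hnn : ∀ x ∈ P, 0 ≤ B x x := fun x hx => by
    by_cases h : x = 0
    · simp [h]
    · exact (hP x hx h).le
  rw [sesqExt_self_re]
  by_cases ha0 : a = 0
  · have hb0 : b ≠ 0 := by rintro rfl; simp [ha0] at hx0
    exact add_pos_of_nonneg_of_pos (hnn a ha) (hP b hb hb0)
  · exact add_pos_of_pos_of_nonneg (hP a ha ha0) (hnn b hb)

/-- At `a + i b` the extension takes the value `B(a, a) + B(b, b)`, so complexifying real definite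
subspaces of maximal dimension gives complex definite ones of complementary dimensions. -/
theorem posInertia_sesqExt [FiniteDimensional ℝ H] {B : LinearMap.BilinForm ℝ H}
    (hrad : B.toQuadraticMap.radical = ⊥) :
    posInertia ⊤ (fun x y => sesqExt B x y) = sigPos B.toQuadraticMap := by
  obtain ⟨P, hPd, hP⟩ := exists_finrank_eq_sigPos_and_posDef B.toQuadraticMap
  obtain ⟨N, hNd, hN⟩ := exists_finrank_eq_sigNeg_and_negDef B.toQuadraticMap
  have hsum := QuadraticForm.sigPos_add_sigNeg_add_radical (Q := B.toQuadraticMap)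
  rw [hrad, finrank_bot, add_zero] at hsum
  have hP' : ∀ x ∈ P, x ≠ 0 → 0 < B x x := fun x hx h =>
    hP ⟨x, hx⟩ fun h' => h (congrArg Subtype.val h')
  have hN' : ∀ x ∈ N, x ≠ 0 → 0 < (-B) x x := fun x hx h =>
    hN ⟨x, hx⟩ fun h' => h (congrArg Subtype.val h')
  rw [← hPd, ← finrank_submodule_baseChange P]
  refine posInertia_eq_finrank (N := N.baseChange ℂ) le_top le_top
    (fun x hx hx0 => sesqExt_posDef hP' hx hx0) (fun x hx => ?_) ?_
  · by_cases h0 : x = 0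
    · simp [h0]
    · obtain ⟨a, ha, b, hb, rfl⟩ := exists_eq_tmul_add_tmul N hx
      have := sesqExt_posDef hN' hx h0
      rw [sesqExt_self_re] at this ⊢
      simp only [LinearMap.neg_apply] at this
      linarith
  · rw [finrank_submodule_baseChange, finrank_submodule_baseChange, finrank_top, finrank_baseChange,
      hPd, hNd, hsum]

theorem baseChange_nondegenerate [FiniteDimensional ℝ H] {B : LinearMap.BilinForm ℝ H}
    (hB : ∀ x, (∀ y, B x y = 0) → x = 0) {x : ℂ ⊗[ℝ] H} (hx : ∀ y, B.baseChange ℂ x y = 0) :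
    x = 0 := by
  have hx' : x ∈ (⊤ : Submodule ℝ H).baseChange ℂ := by simp
  obtain ⟨a, -, b, -, rfl⟩ := exists_eq_tmul_add_tmul ⊤ hx'
  have key : ∀ y, B a y = 0 ∧ B b y = 0 := by
    intro y
    have := hx (1 ⊗ₜ[ℝ] y)
    simp only [map_add, LinearMap.add_apply, LinearMap.BilinForm.baseChange_tmul] at this
    have h1 := congrArg Complex.re this
    have h2 := congrArg Complex.im this
    simp at h1 h2
    exact ⟨h1, h2⟩
  rw [hB a fun y => (key y).1, hB b fun y => (key y).2]
  simp

theorem continuous_sesqExt {T : Type*} [TopologicalSpace T] {B : T → LinearMap.BilinForm ℝ H}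
    (hB : ∀ x y, Continuous fun t => B t x y) (x y : ℂ ⊗[ℝ] H) :
    Continuous fun t => sesqExt (B t) x y := by
  induction x with
  | zero => simpa using continuous_const
  | tmul z x =>
    induction y with
    | zero => simpa using continuous_const
    | tmul w y =>
      have : (fun t => sesqExt (B t) (z ⊗ₜ[ℝ] x) (w ⊗ₜ[ℝ] y)) =
          fun t => B t x y • (w * conj z) := by
        ext t
        simp [LinearMap.BilinForm.baseChange_tmul, mul_comm]
      rw [this]
      exact (hB x y).smul continuous_const
    | add x y hx hy => simp only [map_add]; exact hx.add hy
  | add x y hx hy => simp only [map_add, LinearMap.add_apply]; exact hx.add hy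

/-- The image of a complex subspace under complex conjugation. -/
noncomputable def conjSubmodule (P : Submodule ℂ (ℂ ⊗[ℝ] H)) : Submodule ℂ (ℂ ⊗[ℝ] H) :=
  P.comap (conjCₛₗ H)

@[simp]
theorem mem_conjSubmodule {P : Submodule ℂ (ℂ ⊗[ℝ] H)} {x : ℂ ⊗[ℝ] H} :
    x ∈ conjSubmodule P ↔ conjC H x ∈ P := Iff.rfl

theorem finrank_conjSubmodule (P : Submodule ℂ (ℂ ⊗[ℝ] H)) :
    finrank ℂ (conjSubmodule P) = finrank ℂ P := by
  let j : conjSubmodule P ≃+ P :=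
    { toFun := fun x => ⟨conjC H x, x.2⟩
      invFun := fun x => ⟨conjC H x, by simp⟩
      left_inv := fun x => by simp
      right_inv := fun x => by simp
      map_add' := fun x y => Subtype.ext (by simp) }
  unfold finrank
  rw [rank_eq_of_equiv_equiv (starRingEnd ℂ) j (star_involutive.bijective (α := ℂ))
    fun r m => Subtype.ext (conjC_smul r (m : ℂ ⊗[ℝ] H))]

/-- As `A` is real, conjugation carries the generalized eigenspace of `z` to that of `conj z`. -/
theorem conjC_mem_spectralSum {A : End ℝ H} {s t : Set ℂ} (hst : ∀ z ∈ s, conj z ∈ t)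
    {x : ℂ ⊗[ℝ] H} (hx : x ∈ spectralSum (A.baseChange ℂ) s) :
    conjC H x ∈ spectralSum (A.baseChange ℂ) t := by
  suffices h : spectralSum (A.baseChange ℂ) s ≤ conjSubmodule (spectralSum (A.baseChange ℂ) t) from
    h hx
  refine spectralSum_le fun z hz y hy => ?_
  refine maxGenEigenspace_le_spectralSum _ (hst z hz) ?_
  obtain ⟨k, hk⟩ := (Module.End.mem_maxGenEigenspace _ z y).1 hy
  refine (Module.End.mem_maxGenEigenspace _ _ _).2 ⟨k, ?_⟩
  have hstep : ∀ x : ℂ ⊗[ℝ] H, (A.baseChange ℂ - conj z • (1 : End ℂ (ℂ ⊗[ℝ] H))) (conjC H x) =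
      conjC H ((A.baseChange ℂ - z • (1 : End ℂ (ℂ ⊗[ℝ] H))) x) := by
    intro x
    simp [conjC_baseChange, conjC_smul]
  have hpow : ∀ (k : ℕ) (x : ℂ ⊗[ℝ] H),
      ((A.baseChange ℂ - conj z • (1 : End ℂ (ℂ ⊗[ℝ] H))) ^ k) (conjC H x) =
        conjC H (((A.baseChange ℂ - z • (1 : End ℂ (ℂ ⊗[ℝ] H))) ^ k) x) := by
    intro k
    induction k with
    | zero => simp
    | succ k ih =>
      intro x
      rw [pow_succ, pow_succ, Module.End.mul_apply, Module.End.mul_apply, hstep, ih]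
  rw [conjCₛₗ_apply, hpow, hk, map_zero]

end Complexification

/-! ### The Krein index as half a signature on the whole space -/

section KreinSignature

/-- The form is nonnegative on the direct sum of `P`, `P'` and the isotropic `R`, so this sum meets
the negative definite `N` only in zero. -/
theorem finrank_add_le_of_nonneg {V : Type*} [AddCommGroup V] [Module ℂ V] [FiniteDimensional ℂ V]
    {b : V →ₗ⋆[ℂ] V →ₗ[ℂ] ℂ} {P P' R N : Submodule ℂ V}
    (hP : ∀ x ∈ P, 0 ≤ (b x x).re) (hP' : ∀ x ∈ P', 0 ≤ (b x x).re)
    (hR : ∀ x ∈ R, b x x = 0) (hN : ∀ x ∈ N, x ≠ 0 → (b x x).re < 0)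
    (hPP' : ∀ x ∈ P, ∀ y ∈ P', b x y = 0 ∧ b y x = 0)
    (hPR : ∀ x ∈ P, ∀ y ∈ R, b x y = 0 ∧ b y x = 0)
    (hP'R : ∀ x ∈ P', ∀ y ∈ R, b x y = 0 ∧ b y x = 0)
    (d1 : Disjoint P P') (d2 : Disjoint (P ⊔ P') R) :
    finrank ℂ P + finrank ℂ P' + finrank ℂ R + finrank ℂ N ≤ finrank ℂ V := by
  have d3 : Disjoint (P ⊔ P' ⊔ R) N := by
    rw [Submodule.disjoint_def]
    intro w hw hwN
    by_contra h0
    have hneg := hN w hwN h0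
    obtain ⟨u, hu, r, hr, rfl⟩ := Submodule.mem_sup.1 hw
    obtain ⟨p, hp, q, hq, rfl⟩ := Submodule.mem_sup.1 hu
    have e : b (p + q + r) (p + q + r) = b p p + b q q := by
      simp only [map_add, LinearMap.add_apply, (hPP' p hp q hq).1, (hPP' p hp q hq).2,
        (hPR p hp r hr).1, (hPR p hp r hr).2, (hP'R q hq r hr).1, (hP'R q hq r hr).2, hR r hr]
      ring
    rw [e, Complex.add_re] at hneg
    have := hP p hp
    have := hP' q hq
    linarith
  have h1 := Submodule.finrank_sup_add_finrank_inf_eq P P'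
  have h2 := Submodule.finrank_sup_add_finrank_inf_eq (P ⊔ P') R
  have h3 := Submodule.finrank_sup_add_finrank_inf_eq (P ⊔ P' ⊔ R) N
  rw [d1.eq_bot, finrank_bot] at h1
  rw [d2.eq_bot, finrank_bot] at h2
  rw [d3.eq_bot, finrank_bot] at h3
  have h4 := (P ⊔ P' ⊔ R ⊔ N).finrank_le
  omega

variable {H : Type*} [AddCommGroup H] [Module ℝ H]

/-- The bilinear form `ω(x, A y) - ω(A x, y)`. For alternating `ω` it is symmetric, with quadratic
form `2 ω(x, A x)`. -/
def symmForm (ω : LinearMap.BilinForm ℝ H) (A : End ℝ H) : LinearMap.BilinForm ℝ H :=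
  ω.compRight A - ω.compLeft A

@[simp]
theorem symmForm_apply (ω : LinearMap.BilinForm ℝ H) (A : End ℝ H) (x y : H) :
    symmForm ω A x y = ω x (A y) - ω (A x) y := rfl

theorem symmForm_swap {ω : LinearMap.BilinForm ℝ H} (hAlt : ω.IsAlt) (A : End ℝ H) (x y : H) :
    symmForm ω A x y = (1 : ℝ) * symmForm ω A y x := by
  rw [symmForm_apply, symmForm_apply, ← hAlt.neg_eq x, ← hAlt.neg_eq (A x)]
  ring

theorem sesqExt_symmForm (ω : LinearMap.BilinForm ℝ H) (A : End ℝ H) (x y : ℂ ⊗[ℝ] H) :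
    sesqExt (symmForm ω A) x y = ω.baseChange ℂ (conjC H x) (A.baseChange ℂ y) -
      ω.baseChange ℂ (A.baseChange ℂ (conjC H x)) y := by
  rw [sesqExt_apply]
  induction conjC H x with
  | zero => simp
  | tmul z x =>
    induction y with
    | zero => simp
    | tmul w y => simp [LinearMap.BilinForm.baseChange_tmul]; ring
    | add x y hx hy => simp only [map_add, hx, hy]; ring
  | add x y hx hy => simp only [map_add, LinearMap.add_apply, hx, hy]; ring

theorem baseChange_symplectic {ω : LinearMap.BilinForm ℝ H} {A : End ℝ H} (hA : A ∈ Sp ω)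
    (x y : ℂ ⊗[ℝ] H) :
    ω.baseChange ℂ (A.baseChange ℂ x) (A.baseChange ℂ y) = ω.baseChange ℂ x y := by
  induction x with
  | zero => simp
  | tmul z x =>
    induction y with
    | zero => simp
    | tmul w y => simp [LinearMap.BilinForm.baseChange_tmul, hA x y]
    | add x y hx hy => simp only [map_add, hx, hy]
  | add x y hx hy => simp only [map_add, LinearMap.add_apply, hx, hy]

theorem kreinForm_eq (ω : LinearMap.BilinForm ℝ H) (x y : ℂ ⊗[ℝ] H) :
    kreinForm ω x y = (Complex.I • sesqExt ω) x y := rfl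

theorem injective_of_mem_Sp {ω : LinearMap.BilinForm ℝ H} (hNondeg : ω.Nondegenerate) {A : End ℝ H}
    (hA : A ∈ Sp ω) : Function.Injective A := by
  rw [← LinearMap.ker_eq_bot, LinearMap.ker_eq_bot']
  intro x hx
  refine hNondeg.1 x fun y => ?_
  rw [← hA x y, hx]
  simp

theorem baseChange_surjective {f : End ℝ H} (h : Function.Surjective f) :
    Function.Surjective (f.baseChange ℂ) :=
  LinearMap.lTensor_surjective ℂ h

theorem baseChange_injective {f : End ℝ H} (h : Function.Injective f) :
    Function.Injective (f.baseChange ℂ) :=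
  Module.Flat.lTensor_preserves_injective_linearMap (M := ℂ) f h

/-- An endomorphism without the real eigenvalue `r` has no generalized eigenvectors for `r` in the
complexification. -/
theorem maxGenEigenspace_baseChange_ofReal_eq_bot {A : End ℝ H} {r : ℝ} (hr : r ∉ spectrum ℝ A) :
    Module.End.maxGenEigenspace (A.baseChange ℂ : End ℂ (ℂ ⊗[ℝ] H)) (r : ℂ) = ⊥ := by
  have hu : IsUnit (algebraMap ℝ (End ℝ H) r - A) := by simpa [spectrum.mem_iff] using hr
  have hinj : Function.Injective (A - r • (1 : End ℝ H)) := by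
    have := ((Module.End.isUnit_iff _).1 hu.neg).1
    simpa [Algebra.algebraMap_eq_smul_one] using this
  have hinj' := baseChange_injective hinj
  have heq : ((A - r • (1 : End ℝ H)).baseChange ℂ : End ℂ (ℂ ⊗[ℝ] H)) =
      A.baseChange ℂ - (r : ℂ) • (1 : End ℂ (ℂ ⊗[ℝ] H)) := by
    ext x
    simp [TensorProduct.smul_tmul']
  rw [heq] at hinj'
  rw [eq_bot_iff]
  intro x hx
  obtain ⟨k, hk⟩ := (Module.End.mem_maxGenEigenspace _ _ x).1 hx
  rw [Submodule.mem_bot]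
  have hk' : Function.Injective
      ((A.baseChange ℂ - (r : ℂ) • (1 : End ℂ (ℂ ⊗[ℝ] H)) : End ℂ (ℂ ⊗[ℝ] H)) ^ k) := by
    rw [Module.End.coe_pow]; exact hinj'.iterate k
  exact hk' (by rw [hk, map_zero])

/-- The signature of the hermitian form attached to `ω(x, A x)` is twice the Krein index. -/
theorem two_mul_kreinIndex [FiniteDimensional ℝ H] {ω : LinearMap.BilinForm ℝ H} (hAlt : ω.IsAlt)
    (hNondeg : ω.Nondegenerate) {A : End ℝ H} (hA : A ∈ Sp ω) (h1 : (1 : ℝ) ∉ spectrum ℝ A)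
    (h1' : (-1 : ℝ) ∉ spectrum ℝ A) :
    2 * kreinIndex ω A = (posInertia ⊤ (fun x y => sesqExt (symmForm ω A) x y) : ℤ) -
      posInertia ⊤ (fun x y => -sesqExt (symmForm ω A) x y) := by
  set f : End ℂ (ℂ ⊗[ℝ] H) := A.baseChange ℂ with hf
  set Ω := ω.baseChange ℂ with hΩ
  set S := sesqExt (symmForm ω A) with hSdef
  have hS : ∀ x y, S x y = Ω (conjC H x) (f y) - Ω (f (conjC H x)) y := sesqExt_symmForm ω A
  have hinv : ∀ x y, Ω (f x) (f y) = Ω x y := baseChange_symplectic hA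
  have hsurj : Function.Surjective f := baseChange_surjective
    (LinearMap.injective_iff_surjective.1 (injective_of_mem_Sp hNondeg hA))
  have hΩnd : ∀ x, (∀ y, Ω x y = 0) → x = 0 := fun x hx => baseChange_nondegenerate hNondeg.1 hx
  have hSherm : ∀ x y, conj (S x y) = S y x := fun x y => by
    rw [conj_sesqExt (symmForm_swap hAlt A), Complex.ofReal_one, one_mul]
  set K : Set ℂ := {z : ℂ | ‖z‖ ^ 2 = 1 ∧ 0 < z.im} with hK
  let K' : Set ℂ := {z : ℂ | ‖z‖ ^ 2 = 1 ∧ z.im < 0}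
  let Lt : Set ℂ := {z : ℂ | ‖z‖ < 1}
  let Gt : Set ℂ := {z : ℂ | 1 < ‖z‖}
  have hKn : ∀ z ∈ K, ‖z‖ = 1 := fun z hz => by
    have h : ‖z‖ ^ 2 = 1 := hz.1
    exact (pow_eq_one_iff_of_nonneg (norm_nonneg z) two_ne_zero).1 h
  have hKn' : ∀ z ∈ K', ‖z‖ = 1 := fun z hz => by
    have h : ‖z‖ ^ 2 = 1 := hz.1
    exact (pow_eq_one_iff_of_nonneg (norm_nonneg z) two_ne_zero).1 h
  set E := spectralSum f K with hE
  have hEk : kreinSpace A = E := rfl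
  -- orthogonality of spectral subspaces
  have hΩort : ∀ {s t : Set ℂ}, (∀ z ∈ s, ∀ w ∈ t, conj z * w ≠ 1) → ∀ x ∈ spectralSum f s,
      ∀ y ∈ spectralSum f t, Ω (conjC H x) y = 0 := by
    intro s t hst x hx y hy
    refine apply_eq_zero_of_mem_spectralSum (s := conj ⁻¹' s) hinv (fun z hz w hw => ?_)
      (conjC_mem_spectralSum (fun z hz => ?_) hx) hy
    · simpa using hst _ hz w hw
    · simpa using hz
  have hSort : ∀ {s t : Set ℂ}, (∀ z ∈ s, ∀ w ∈ t, conj z * w ≠ 1) → ∀ x ∈ spectralSum f s,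
      ∀ y ∈ spectralSum f t, S x y = 0 := by
    intro s t hst x hx y hy
    rw [hS, hf, ← conjC_baseChange, ← hf, hΩort hst x hx _ (apply_mem_spectralSum hy),
      hΩort hst _ (apply_mem_spectralSum hx) y hy, sub_zero]
  have norm_ne : ∀ {z w : ℂ}, ‖z‖ * ‖w‖ ≠ 1 → conj z * w ≠ 1 := by
    intro z w h h'
    have := congrArg norm h'
    rw [norm_mul, Complex.norm_conj, norm_one] at this
    exact h this
  have oKK' : ∀ z ∈ K, ∀ w ∈ K', conj z * w ≠ 1 := by
    intro z hz w hw h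
    have hzz : z * conj z = 1 := by rw [Complex.mul_conj, Complex.normSq_eq_norm_sq, hz.1]; simp
    have : w = z := by linear_combination z * h - w * hzz
    have h3 := hz.2
    have h4 := hw.2
    rw [this] at h4
    linarith
  have oK'K : ∀ z ∈ K', ∀ w ∈ K, conj z * w ≠ 1 := by
    intro z hz w hw h
    refine oKK' w hw z hz ?_
    have := congrArg conj h
    simpa [mul_comm] using this
  have oKLt : ∀ z ∈ K, ∀ w ∈ Lt, conj z * w ≠ 1 := fun z hz w hw => norm_ne (by
    rw [hKn z hz, one_mul]; exact (ne_of_lt hw))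
  have oKGt : ∀ z ∈ K, ∀ w ∈ Gt, conj z * w ≠ 1 := fun z hz w hw => norm_ne (by
    rw [hKn z hz, one_mul]; exact (ne_of_gt hw))
  have oK'Lt : ∀ z ∈ K', ∀ w ∈ Lt, conj z * w ≠ 1 := fun z hz w hw => norm_ne (by
    rw [hKn' z hz, one_mul]; exact (ne_of_lt hw))
  have oK'Gt : ∀ z ∈ K', ∀ w ∈ Gt, conj z * w ≠ 1 := fun z hz w hw => norm_ne (by
    rw [hKn' z hz, one_mul]; exact (ne_of_gt hw))
  have oLtLt : ∀ z ∈ Lt, ∀ w ∈ Lt, conj z * w ≠ 1 := fun z hz w hw => norm_ne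
    (mul_lt_one_of_nonneg_of_lt_one_left (norm_nonneg _) hz (le_of_lt hw)).ne
  have oGtGt : ∀ z ∈ Gt, ∀ w ∈ Gt, conj z * w ≠ 1 := fun z hz w hw => norm_ne
    (one_lt_mul_of_lt_of_le hz (le_of_lt hw)).ne'
  have oflip : ∀ {s t : Set ℂ}, (∀ z ∈ s, ∀ w ∈ t, conj z * w ≠ 1) →
      ∀ z ∈ t, ∀ w ∈ s, conj z * w ≠ 1 := by
    intro s t h z hz w hw h'
    refine h w hw z hz ?_
    have := congrArg conj h'
    simpa [mul_comm] using this
  -- the spectral subspaces span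
  have hspan : spectralSum f K ⊔ spectralSum f K' ⊔ spectralSum f Lt ⊔ spectralSum f Gt = ⊤ := by
    rw [eq_top_iff, ← Module.End.iSup_maxGenEigenspace_eq_top f]
    refine iSup_le fun z => ?_
    rcases lt_trichotomy ‖z‖ 1 with hz | hz | hz
    · exact le_sup_of_le_left (le_sup_of_le_right (maxGenEigenspace_le_spectralSum f hz))
    · rcases lt_trichotomy z.im 0 with hi | hi | hi
      · exact le_sup_of_le_left (le_sup_of_le_left (le_sup_of_le_right
          (maxGenEigenspace_le_spectralSum f ⟨by rw [hz]; norm_num, hi⟩)))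
      · have hzr : z = (z.re : ℂ) := Complex.ext rfl (by simpa using hi)
        have hre : z.re = 1 ∨ z.re = -1 := by
          rw [hzr, Complex.norm_real, Real.norm_eq_abs] at hz
          exact eq_or_eq_neg_of_abs_eq hz
        have hbot : f.maxGenEigenspace z = ⊥ := by
          rw [hzr]
          rcases hre with h | h <;> rw [h]
          · exact maxGenEigenspace_baseChange_ofReal_eq_bot h1
          · exact maxGenEigenspace_baseChange_ofReal_eq_bot h1'
        rw [hbot]
        exact bot_le
      · exact le_sup_of_le_left (le_sup_of_le_left (le_sup_of_le_left
          (maxGenEigenspace_le_spectralSum f ⟨by rw [hz]; norm_num, hi⟩)))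
    · exact le_sup_of_le_right (maxGenEigenspace_le_spectralSum f hz)
  have hdec : ∀ y : ℂ ⊗[ℝ] H, ∃ a ∈ spectralSum f K, ∃ b ∈ spectralSum f K',
      ∃ c ∈ spectralSum f Lt, ∃ d ∈ spectralSum f Gt, a + b + c + d = y := by
    intro y
    have hy : y ∈ spectralSum f K ⊔ spectralSum f K' ⊔ spectralSum f Lt ⊔ spectralSum f Gt := by
      rw [hspan]; trivial
    obtain ⟨u, hu, d, hd, rfl⟩ := Submodule.mem_sup.1 hy
    obtain ⟨v, hv, c, hc, rfl⟩ := Submodule.mem_sup.1 hu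
    obtain ⟨a, ha, b, hb, rfl⟩ := Submodule.mem_sup.1 hv
    exact ⟨a, ha, b, hb, c, hc, d, hd, rfl⟩
  -- the interpolating family of forms
  let b : unitInterval → (ℂ ⊗[ℝ] H →ₗ⋆[ℂ] ℂ ⊗[ℝ] H →ₗ[ℂ] ℂ) := fun t =>
    ((1 - (t : ℝ) : ℝ) : ℂ) • (Complex.I • sesqExt ω) + ((t : ℝ) : ℂ) • S
  have hbval : ∀ t x y, b t x y = ((1 - (t : ℝ) : ℝ) : ℂ) * (Complex.I * Ω (conjC H x) y) +
      ((t : ℝ) : ℂ) * S x y := fun t x y => rfl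
  have hbherm : ∀ t x y, conj (b t x y) = b t y x := by
    intro t x y
    have hω : conj (sesqExt ω x y) = ((-1 : ℝ) : ℂ) * sesqExt ω y x :=
      conj_sesqExt (fun x y => by rw [← hAlt.neg_eq x]; ring) x y
    rw [sesqExt_apply, sesqExt_apply, ← hΩ] at hω
    rw [hbval, hbval, map_add, map_mul, map_mul, map_mul, Complex.conj_ofReal, Complex.conj_ofReal,
      Complex.conj_I, hω, hSherm]
    push_cast
    ring
  have hbnd : ∀ t, ∀ x ∈ E, (∀ y ∈ E, b t x y = 0) → x = 0 := by
    intro t x hx hxy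
    have hall : ∀ y, b t x y = 0 := by
      intro y
      obtain ⟨a, ha, b', hb, c, hc, d, hd, rfl⟩ := hdec y
      simp only [map_add, hxy a ha]
      simp only [hbval, hΩort oKK' x hx b' hb, hSort oKK' x hx b' hb, hΩort oKLt x hx c hc,
        hSort oKLt x hx c hc, hΩort oKGt x hx d hd, hSort oKGt x hx d hd]
      ring
    -- Pairing with `f y` and using invariance of `Ω` rewrites `b t x y = 0` as a quadratic equation
    -- in `f` for the conjugate of `x`. Conjugated, it says that `t f² + (1 - t) i f - t` kills `x`.
    have hker : ((1 - (t : ℝ) : ℝ) * Complex.I : ℂ) • f (conjC H x) +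
        ((t : ℝ) : ℂ) • (conjC H x - f (f (conjC H x))) = 0 := by
      refine hΩnd _ fun y => ?_
      obtain ⟨y, rfl⟩ := hsurj y
      have := hall y
      rw [hbval, hS] at this
      simp only [map_add, map_sub, map_smul, LinearMap.add_apply, LinearMap.sub_apply,
        LinearMap.smul_apply, smul_eq_mul, hinv]
      rw [← this]
      ring
    have hker' := congrArg (conjC H) hker
    simp only [map_add, map_sub, conjC_smul, hf, conjC_baseChange, conjC_conjC, map_zero, map_mul,
      Complex.conj_ofReal, Complex.conj_I] at hker'
    rw [← hf] at hker'
    refine eq_zero_of_quadratic_of_mem_spectralSum (f := f) (a := ((t : ℝ) : ℂ))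
      (b := (1 - (t : ℝ) : ℝ) * Complex.I) (c := -((t : ℝ) : ℂ)) (s := K) ?_ hx ?_
    -- Dividing by `z` on the unit circle leaves `t z + (1 - t) i - t z̄`, whose imaginary part `(1
    -- - t) + 2 t im z` is positive on the upper half circle.
    · intro z hz h0
      have hzz : z * conj z = 1 := by rw [Complex.mul_conj, Complex.normSq_eq_norm_sq, hz.1]; simp
      have h2 : ((t : ℝ) : ℂ) * z + (1 - (t : ℝ) : ℝ) * Complex.I - ((t : ℝ) : ℂ) * conj z = 0 := by
        linear_combination conj z * h0 -
          (((t : ℝ) : ℂ) * z + (1 - (t : ℝ) : ℝ) * Complex.I) * hzz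
      have h3 := congrArg Complex.im h2
      simp only [Complex.sub_im, Complex.add_im, Complex.im_ofReal_mul, Complex.conj_im,
        Complex.I_im, Complex.zero_im] at h3
      have ht0 := t.2.1
      have ht1 := t.2.2
      have him := hz.2
      rcases eq_or_lt_of_le ht0 with h | h
      · rw [← h] at h3; norm_num at h3
      · have := mul_pos h him
        linarith
    · rw [← neg_eq_zero, ← hker']
      module
  have hbc : ∀ x y, Continuous fun t => b t x y := by
    intro x y
    simp only [hbval]
    fun_prop
  have hpos : posInertia E (kreinForm ω) = posInertia E (fun x y => S x y) := by
    have h := (isLocallyConstant_posInertia hbherm hbc E hbnd).apply_eq_of_preconnectedSpace 0 1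
    have h0 : (kreinForm ω) = fun x y => kreinForm ω x y := rfl
    rw [h0]
    simpa [b, kreinForm_eq] using h
  have hneg : posInertia E (fun x y => -kreinForm ω x y) = posInertia E (fun x y => -S x y) := by
    have h := (isLocallyConstant_posInertia (b := fun t => -b t)
      (fun t x y => by simp [hbherm]) (fun x y => (hbc x y).neg) E
      (fun t x hx h => hbnd t x hx (by simpa using h))).apply_eq_of_preconnectedSpace 0 1
    simpa [b, kreinForm_eq] using h
  have hSndE : ∀ x ∈ E, (∀ y ∈ E, S x y = 0) → x = 0 := fun x hx h =>
    hbnd 1 x hx fun y hy => by simp [hbval, h y hy]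
  have hSnd : ∀ x ∈ (⊤ : Submodule ℂ (ℂ ⊗[ℝ] H)), (∀ y ∈ (⊤ : Submodule ℂ (ℂ ⊗[ℝ] H)), S x y = 0) →
      x = 0 := by
    intro x _ hx
    -- On the whole space the radical of `S` corresponds to the kernel of `f² - 1`, which is zero
    -- because `±1` are not eigenvalues.
    have hker : (1 : ℂ) • f (f (conjC H x)) + (0 : ℂ) • f (conjC H x) + (-1 : ℂ) • conjC H x = 0 := by
      rw [← neg_eq_zero]
      refine hΩnd _ fun y => ?_
      obtain ⟨y, rfl⟩ := hsurj y
      have := hx y trivial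
      rw [hS] at this
      simp only [map_add, map_neg, map_smul, LinearMap.add_apply, LinearMap.neg_apply,
        LinearMap.smul_apply, smul_eq_mul, hinv]
      linear_combination this
    have hx0 : conjC H x = 0 := by
      refine eq_zero_of_quadratic_of_mem_spectralSum (f := f) (s := {z | z ≠ 1 ∧ z ≠ -1}) ?_ ?_ hker
      · rintro z ⟨hz, hz'⟩ h
        have : (z - 1) * (z + 1) = 0 := by linear_combination h
        rcases mul_eq_zero.1 this with h | h
        · exact hz (sub_eq_zero.1 h)
        · exact hz' (eq_neg_of_add_eq_zero_left h)
      · have htop : spectralSum f {z | z ≠ 1 ∧ z ≠ -1} = ⊤ := by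
          rw [eq_top_iff, ← Module.End.iSup_maxGenEigenspace_eq_top f]
          refine iSup_le fun z => ?_
          by_cases hz : z = 1
          · have := maxGenEigenspace_baseChange_ofReal_eq_bot h1
            rw [Complex.ofReal_one, ← hf, ← hz] at this
            rw [this]; exact bot_le
          by_cases hz' : z = -1
          · have := maxGenEigenspace_baseChange_ofReal_eq_bot h1'
            rw [Complex.ofReal_neg, Complex.ofReal_one, ← hf, ← hz'] at this
            rw [this]; exact bot_le
          exact maxGenEigenspace_le_spectralSum f ⟨hz, hz'⟩
        rw [htop]; trivial
    rw [← conjC_conjC x, hx0, map_zero]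
  -- decompositions of `E` and of the whole space
  obtain ⟨P, hPE, N, hNE, hP, hN, hdimE⟩ := exists_posDef_negDef_decomposition hSherm E hSndE
  obtain ⟨PV, -, NV, -, hPV, hNV, hdimV⟩ := exists_posDef_negDef_decomposition hSherm ⊤ hSnd
  have weak : ∀ {W : Submodule ℂ (ℂ ⊗[ℝ] H)}, (∀ x ∈ W, x ≠ 0 → (S x x).re < 0) →
      ∀ x ∈ W, (S x x).re ≤ 0 := fun {W} h x hx => by
    by_cases h0 : x = 0
    · simp [h0]
    · exact (h x hx h0).le
  have weak' : ∀ {W : Submodule ℂ (ℂ ⊗[ℝ] H)}, (∀ x ∈ W, x ≠ 0 → 0 < (S x x).re) →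
      ∀ x ∈ W, 0 ≤ (S x x).re := fun {W} h x hx => by
    by_cases h0 : x = 0
    · simp [h0]
    · exact (h x hx h0).le
  rw [kreinIndex, hEk, hpos, hneg, posInertia_eq_finrank hPE hNE hP (weak hN) hdimE.ge,
    posInertia_eq_finrank (b := fun x y => -S x y) hNE hPE (fun x hx h => by simpa using hN x hx h)
      (fun x hx => by simpa using weak' hP x hx) (by omega),
    posInertia_eq_finrank le_top le_top hPV (weak hNV) hdimV.ge,
    posInertia_eq_finrank (b := fun x y => -S x y) le_top le_top
      (fun x hx h => by simpa using hNV x hx h)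
      (fun x hx => by simpa using weak' hPV x hx) (by omega)]
  -- the conjugate subspaces
  have hconjS : ∀ x, (S (conjC H x) (conjC H x)).re = (S x x).re := by
    intro x
    rw [hSdef, sesqExt_apply, baseChange_conjC, Complex.conj_re, sesqExt_apply]
  have hconjK : ∀ {W : Submodule ℂ (ℂ ⊗[ℝ] H)}, W ≤ E → conjSubmodule W ≤ spectralSum f K' := by
    intro W hW x hx
    have := conjC_mem_spectralSum (t := K') (fun z hz => ⟨by simpa using hz.1, by simpa using hz.2⟩)
      (hW hx)
    simpa using this
  have hK'E : spectralSum f K' ≤ conjSubmodule E := fun x hx =>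
    conjC_mem_spectralSum (t := K) (fun z hz => ⟨by simpa using hz.1, by simpa using hz.2⟩) hx
  have dKK' : Disjoint (spectralSum f K) (spectralSum f K') :=
    disjoint_spectralSum f (Set.disjoint_left.2 fun z hz hz' => lt_asymm hz.2 hz'.2)
  have dKL : ∀ {R : Set ℂ}, (∀ z ∈ R, ‖z‖ ≠ 1) →
      Disjoint (spectralSum f K ⊔ spectralSum f K') (spectralSum f R) := by
    intro R hR
    have : spectralSum f K ⊔ spectralSum f K' ≤ spectralSum f (K ∪ K') :=
      sup_le (spectralSum_le fun z hz => maxGenEigenspace_le_spectralSum f (Or.inl hz))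
        (spectralSum_le fun z hz => maxGenEigenspace_le_spectralSum f (Or.inr hz))
    refine Disjoint.mono_left this (disjoint_spectralSum f (Set.disjoint_left.2 ?_))
    rintro z (hz | hz) hz'
    · exact hR z hz' (hKn z hz)
    · exact hR z hz' (hKn' z hz)
  -- The definite part of `E`, its conjugate and an isotropic spectral subspace are mutually
  -- orthogonal; this bounds both indices on the whole space from below.
  have bound : ∀ {R : Set ℂ}, (∀ z ∈ R, ‖z‖ ≠ 1) → (∀ z ∈ K, ∀ w ∈ R, conj z * w ≠ 1) →
      (∀ z ∈ K', ∀ w ∈ R, conj z * w ≠ 1) → (∀ z ∈ R, ∀ w ∈ R, conj z * w ≠ 1) →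
      2 * finrank ℂ P + finrank ℂ (spectralSum f R) + finrank ℂ NV ≤ finrank ℂ (ℂ ⊗[ℝ] H) ∧
      2 * finrank ℂ N + finrank ℂ (spectralSum f R) + finrank ℂ PV ≤ finrank ℂ (ℂ ⊗[ℝ] H) := by
    intro R hR o1 o2 o3
    constructor
    · have := finrank_add_le_of_nonneg (b := S) (P := P) (P' := conjSubmodule P)
        (R := spectralSum f R) (N := NV) (weak' hP)
        (fun x hx => by rw [← hconjS]; exact weak' hP _ hx) (fun x hx => hSort o3 x hx x hx) hNV
        (fun x hx y hy => ⟨hSort oKK' x (hPE hx) y (hconjK hPE hy),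
          hSort oK'K y (hconjK hPE hy) x (hPE hx)⟩)
        (fun x hx y hy => ⟨hSort o1 x (hPE hx) y hy, hSort (oflip o1) y hy x (hPE hx)⟩)
        (fun x hx y hy => ⟨hSort o2 x (hconjK hPE hx) y hy,
          hSort (oflip o2) y hy x (hconjK hPE hx)⟩)
        (dKK'.mono hPE (hconjK hPE)) ((dKL hR).mono_left (sup_le_sup hPE (hconjK hPE)))
      rw [finrank_conjSubmodule] at this
      omega
    · have := finrank_add_le_of_nonneg (b := -S) (P := N) (P' := conjSubmodule N)
        (R := spectralSum f R) (N := PV) (fun x hx => by simpa using weak hN x hx)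
        (fun x hx => by
          have := weak hN _ hx
          rw [conjCₛₗ_apply, hconjS] at this
          simpa using this)
        (fun x hx => by simpa using hSort o3 x hx x hx)
        (fun x hx h => by simpa using hPV x hx h)
        (fun x hx y hy => by
          simpa using And.intro (hSort oKK' x (hNE hx) y (hconjK hNE hy))
            (hSort oK'K y (hconjK hNE hy) x (hNE hx)))
        (fun x hx y hy => by
          simpa using And.intro (hSort o1 x (hNE hx) y hy) (hSort (oflip o1) y hy x (hNE hx)))
        (fun x hx y hy => by
          simpa using And.intro (hSort o2 x (hconjK hNE hx) y hy)
            (hSort (oflip o2) y hy x (hconjK hNE hx)))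
        (dKK'.mono hNE (hconjK hNE)) ((dKL hR).mono_left (sup_le_sup hNE (hconjK hNE)))
      rw [finrank_conjSubmodule] at this
      omega
  have b1 := bound (R := Lt) (fun z hz => ne_of_lt hz) oKLt oK'Lt oLtLt
  have b2 := bound (R := Gt) (fun z hz => ne_of_gt hz) oKGt oK'Gt oGtGt
  have hK'dim : finrank ℂ (spectralSum f K') ≤ finrank ℂ E := by
    rw [← finrank_conjSubmodule E]
    exact Submodule.finrank_mono hK'E
  have htot : finrank ℂ (ℂ ⊗[ℝ] H) ≤ finrank ℂ E + finrank ℂ (spectralSum f K') +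
      finrank ℂ (spectralSum f Lt) + finrank ℂ (spectralSum f Gt) := by
    rw [← finrank_top ℂ (ℂ ⊗[ℝ] H), ← hspan, hE]
    have e1 := Submodule.finrank_add_le_finrank_add_finrank (spectralSum f K) (spectralSum f K')
    have e2 := Submodule.finrank_add_le_finrank_add_finrank
      (spectralSum f K ⊔ spectralSum f K') (spectralSum f Lt)
    have e3 := Submodule.finrank_add_le_finrank_add_finrank
      (spectralSum f K ⊔ spectralSum f K' ⊔ spectralSum f Lt) (spectralSum f Gt)
    omega
  -- With `p, q` the indices on `E`, `p', q'` those on the whole space and `l, g` the dimensions for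
  -- `Lt` and `Gt`, the bounds say that `2p + l` and `2p + g` are at most `p'`, and `2q + l` and `2q
  -- + g` at most `q'`. Since `p' + q' ≤ 2p + 2q + l + g`, all are equalities, so `p' - q' = 2(p -
  -- q)`.
  rw [finrank_top] at hdimV
  omega

end KreinSignature

/-! ### Topology of the endomorphism algebra -/

section EndTopology

variable {H : Type*} [AddCommGroup H] [Module ℝ H]

/-- The module topology on the endomorphisms of a real vector space. -/
abbrev endTopology (H : Type*) [AddCommGroup H] [Module ℝ H] : TopologicalSpace (End ℝ H) :=
  moduleTopology ℝ (End ℝ H)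

attribute [local instance] endTopology

theorem end_isModuleTopology (H : Type*) [AddCommGroup H] [Module ℝ H] :
    IsModuleTopology ℝ (End ℝ H) := ⟨rfl⟩

attribute [local instance] end_isModuleTopology

theorem end_isTopologicalRing (H : Type*) [AddCommGroup H] [Module ℝ H] [FiniteDimensional ℝ H] :
    IsTopologicalRing (End ℝ H) := IsModuleTopology.isTopologicalRing ℝ _

attribute [local instance] end_isTopologicalRing

theorem continuous_toMatrix {ι : Type*} [Fintype ι] [DecidableEq ι] (v : Basis ι ℝ H) :
    Continuous (LinearMap.toMatrix v v : End ℝ H → Matrix ι ι ℝ) :=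
  IsModuleTopology.continuous_of_linearMap (LinearMap.toMatrix v v).toLinearMap

variable [FiniteDimensional ℝ H]

theorem continuous_toLin {ι : Type*} [Fintype ι] [DecidableEq ι] (v : Basis ι ℝ H) :
    Continuous (Matrix.toLin v v : Matrix ι ι ℝ → End ℝ H) := by
  have : IsModuleTopology ℝ (Matrix ι ι ℝ) := inferInstanceAs (IsModuleTopology ℝ (ι → ι → ℝ))
  exact IsModuleTopology.continuous_of_linearMap (Matrix.toLin v v).toLinearMap

theorem continuous_linearMap_det : Continuous (LinearMap.det : End ℝ H → ℝ) := by
  have : (LinearMap.det : End ℝ H → ℝ) =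
      fun f => (LinearMap.toMatrix (finBasis ℝ H) (finBasis ℝ H) f).det := by
    ext f
    rw [LinearMap.det_toMatrix]
  rw [this]
  exact (continuous_toMatrix _).matrix_det

theorem injective_iff_det_ne_zero {f : End ℝ H} : Function.Injective f ↔ LinearMap.det f ≠ 0 := by
  rw [← isUnit_iff_ne_zero, ← LinearMap.isUnit_iff_isUnit_det, Module.End.isUnit_iff]
  exact ⟨fun h => ⟨h, LinearMap.injective_iff_surjective.1 h⟩, fun h => h.1⟩

theorem isUnit_iff_injective {f : End ℝ H} : IsUnit f ↔ Function.Injective f := by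
  rw [injective_iff_det_ne_zero, ← isUnit_iff_ne_zero, ← LinearMap.isUnit_iff_isUnit_det]

/-- On units the inverse is the adjugate divided by the determinant. -/
theorem continuousOn_ringInverse_end :
    ContinuousOn (Ring.inverse : End ℝ H → End ℝ H) {f | IsUnit f} := by
  let v := finBasis ℝ H
  have heq : ∀ f ∈ {f : End ℝ H | IsUnit f}, Ring.inverse f =
      (LinearMap.det f)⁻¹ • Matrix.toLin v v (LinearMap.toMatrix v v f).adjugate := by
    intro f hf
    have hd : LinearMap.det f ≠ 0 :=
      isUnit_iff_ne_zero.1 ((LinearMap.isUnit_iff_isUnit_det f).1 hf)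
    have hmul : f * ((LinearMap.det f)⁻¹ •
        Matrix.toLin v v (LinearMap.toMatrix v v f).adjugate) = 1 := by
      have h1 := Matrix.toLin_mul v v v (LinearMap.toMatrix v v f) (LinearMap.toMatrix v v f).adjugate
      rw [Matrix.mul_adjugate, Matrix.toLin_toMatrix, LinearMap.det_toMatrix, map_smul,
        Matrix.toLin_one] at h1
      rw [mul_smul_comm, Module.End.mul_eq_comp, ← h1, smul_smul, inv_mul_cancel₀ hd, one_smul]
      rfl
    calc Ring.inverse f = Ring.inverse f * (f * _) := by rw [hmul, mul_one]
      _ = _ := by rw [← mul_assoc, Ring.inverse_mul_cancel f hf, one_mul]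
  refine ContinuousOn.congr ?_ heq
  refine ContinuousOn.smul (ContinuousOn.inv₀ continuous_linearMap_det.continuousOn fun f hf =>
    isUnit_iff_ne_zero.1 ((LinearMap.isUnit_iff_isUnit_det f).1 hf)) ?_
  exact ((continuous_toLin v).comp (continuous_toMatrix v).matrix_adjugate).continuousOn

end EndTopology

/-! ### The Cayley transform -/

section Cayley

variable {H : Type*} [AddCommGroup H] [Module ℝ H]

/-- The infinitesimally symplectic endomorphisms. -/
def skewEnd (ω : LinearMap.BilinForm ℝ H) : Set (End ℝ H) :=
  {X | ∀ x y, ω (X x) y = -ω x (X y)}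

/-- The injective infinitesimally symplectic endomorphisms. -/
def skewReg (ω : LinearMap.BilinForm ℝ H) : Set (End ℝ H) :=
  {X | X ∈ skewEnd ω ∧ Function.Injective X}

/-- The domain of the Cayley transform: injective infinitesimally symplectic endomorphisms without
the eigenvalue `1`. -/
def cayleyDomain (ω : LinearMap.BilinForm ℝ H) : Set (End ℝ H) :=
  {X | X ∈ skewReg ω ∧ Function.Injective (1 - X : End ℝ H)}

/-- The Cayley transform `-(1 + X)(1 - X)⁻¹`. -/
noncomputable def cayley (X : End ℝ H) : End ℝ H :=
  -(1 + X) * Ring.inverse (1 - X)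

/-- The quadratic form `ω(X x, x)`. -/
noncomputable def skewQuad (ω : LinearMap.BilinForm ℝ H) (X : End ℝ H) : QuadraticForm ℝ H :=
  (ω.compLeft X).toQuadraticMap

@[simp]
theorem skewQuad_apply (ω : LinearMap.BilinForm ℝ H) (X : End ℝ H) (x : H) :
    skewQuad ω X x = ω (X x) x := rfl

theorem radical_toQuadraticMap_eq_bot {B : LinearMap.BilinForm ℝ H} (hs : ∀ x y, B x y = B y x)
    (hnd : ∀ x, (∀ y, B x y = 0) → x = 0) : B.toQuadraticMap.radical = ⊥ := by
  rw [eq_bot_iff]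
  intro x hx
  obtain ⟨h0, h⟩ := QuadraticMap.mem_radical_iff'.1 hx
  refine hnd x fun y => ?_
  have h1 := h y
  simp only [LinearMap.BilinMap.toQuadraticMap_apply, map_add, LinearMap.add_apply] at h0 h1
  have := hs x y
  linarith

theorem sesqExt_neg (B : LinearMap.BilinForm ℝ H) (x y : ℂ ⊗[ℝ] H) :
    sesqExt (-B) x y = -sesqExt B x y := by
  rw [sesqExt_apply, sesqExt_apply]
  induction conjC H x with
  | zero => simp
  | tmul z x =>
    induction y with
    | zero => simp
    | tmul w y => simp [LinearMap.BilinForm.baseChange_tmul]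
    | add x y hx hy => simp only [map_add, hx, hy]; ring
  | add x y hx hy => simp only [map_add, LinearMap.add_apply, hx, hy]; ring

theorem skewQuad_radical {ω : LinearMap.BilinForm ℝ H} (hAlt : ω.IsAlt)
    (hNondeg : ω.Nondegenerate) {X : End ℝ H} (hX : X ∈ skewReg ω) :
    (skewQuad ω X).radical = ⊥ := by
  refine radical_toQuadraticMap_eq_bot (fun x y => ?_) fun x hx => ?_
  · change ω (X x) y = ω (X y) x
    rw [hX.1 x y, ← hAlt.neg_eq x]
  · exact hX.2 ((hNondeg.1 (X x) hx).trans (map_zero X).symm)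

variable [FiniteDimensional ℝ H]

/-- Every vector has the form `u - X u`, and in this parametrization the transform needs no inverse;
the computations below all use it. -/
theorem cayley_apply {X : End ℝ H} (hX : Function.Injective (1 - X : End ℝ H)) (u : H) :
    cayley X (u - X u) = -(u + X u) := by
  have h := Ring.inverse_mul_cancel (1 - X) (isUnit_iff_injective.2 hX)
  have hu : Ring.inverse (1 - X) (u - X u) = u := by
    simpa using LinearMap.congr_fun h u
  simp only [cayley, Module.End.mul_apply, hu]
  simp

theorem exists_sub_apply_eq {X : End ℝ H} (hX : Function.Injective (1 - X : End ℝ H)) (x : H) :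
    ∃ u, u - X u = x := by
  obtain ⟨u, hu⟩ := LinearMap.injective_iff_surjective.1 hX x
  exact ⟨u, by simpa using hu⟩

theorem one_sub_cayley {X : End ℝ H} (hX : Function.Injective (1 - X : End ℝ H)) :
    (1 - cayley X) * (1 - X) = (2 : ℝ) • 1 := by
  ext u
  have := cayley_apply hX u
  simp only [Module.End.mul_apply, LinearMap.sub_apply, Module.End.one_apply, this,
    LinearMap.smul_apply]
  module

theorem injective_one_sub_cayley {X : End ℝ H} (hX : Function.Injective (1 - X : End ℝ H)) :
    Function.Injective (1 - cayley X : End ℝ H) := by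
  rw [← LinearMap.ker_eq_bot, LinearMap.ker_eq_bot']
  intro x hx
  obtain ⟨u, rfl⟩ := exists_sub_apply_eq hX x
  have := LinearMap.congr_fun (one_sub_cayley hX) u
  simp only [Module.End.mul_apply, LinearMap.sub_apply, Module.End.one_apply,
    LinearMap.smul_apply] at this hx
  rw [this] at hx
  have : u = 0 := by simpa using hx
  simp [this]

theorem cayley_cayley {X : End ℝ H} (hX : Function.Injective (1 - X : End ℝ H)) : cayley (cayley X) = X := by
  ext x
  have h := cayley_apply (injective_one_sub_cayley hX) ((2 : ℝ)⁻¹ • (x - X x))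
  rw [map_smul, cayley_apply hX] at h
  have e1 : (2 : ℝ)⁻¹ • (x - X x) - (2 : ℝ)⁻¹ • -(x + X x) = x := by module
  rw [e1] at h
  rw [h]
  module

theorem notMem_spectrum_iff {A : End ℝ H} {r : ℝ} :
    r ∉ spectrum ℝ A ↔ Function.Injective (r • 1 - A : End ℝ H) := by
  rw [spectrum.notMem_iff, isUnit_iff_injective, Algebra.algebraMap_eq_smul_one]

theorem cayley_mem {ω : LinearMap.BilinForm ℝ H} {X : End ℝ H} (hX : X ∈ cayleyDomain ω) :
    cayley X ∈ Sp ω ∧ (1 : ℝ) ∉ spectrum ℝ (cayley X) ∧ (-1 : ℝ) ∉ spectrum ℝ (cayley X) := by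
  obtain ⟨⟨hs, hi⟩, h1⟩ := hX
  refine ⟨fun x y => ?_, ?_, ?_⟩
  · obtain ⟨u, rfl⟩ := exists_sub_apply_eq h1 x
    obtain ⟨v, rfl⟩ := exists_sub_apply_eq h1 y
    rw [cayley_apply h1, cayley_apply h1]
    simp only [map_neg, map_add, map_sub, LinearMap.neg_apply, LinearMap.add_apply,
      LinearMap.sub_apply, hs u v]
    ring
  · rw [notMem_spectrum_iff, one_smul]
    exact injective_one_sub_cayley h1
  · rw [notMem_spectrum_iff, ← LinearMap.ker_eq_bot, LinearMap.ker_eq_bot']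
    intro x hx
    obtain ⟨u, rfl⟩ := exists_sub_apply_eq h1 x
    simp only [LinearMap.sub_apply, LinearMap.smul_apply, Module.End.one_apply,
      cayley_apply h1] at hx
    have h2 : X ((2 : ℝ) • u) = X 0 := by
      rw [map_smul, map_zero, ← hx]; module
    have : u = 0 := by simpa using hi h2
    simp [this]

theorem cayley_mem_cayleyDomain {ω : LinearMap.BilinForm ℝ H} {A : End ℝ H} (hA : A ∈ Sp ω)
    (h1 : (1 : ℝ) ∉ spectrum ℝ A) (h1' : (-1 : ℝ) ∉ spectrum ℝ A) : cayley A ∈ cayleyDomain ω := by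
  rw [notMem_spectrum_iff, one_smul] at h1
  rw [notMem_spectrum_iff] at h1'
  refine ⟨⟨fun x y => ?_, ?_⟩, injective_one_sub_cayley h1⟩
  · obtain ⟨u, rfl⟩ := exists_sub_apply_eq h1 x
    obtain ⟨v, rfl⟩ := exists_sub_apply_eq h1 y
    rw [cayley_apply h1, cayley_apply h1]
    simp only [map_neg, map_add, map_sub, LinearMap.neg_apply, LinearMap.add_apply,
      LinearMap.sub_apply, hA u v]
    ring
  · rw [← LinearMap.ker_eq_bot, LinearMap.ker_eq_bot']
    intro x hx
    obtain ⟨u, rfl⟩ := exists_sub_apply_eq h1 x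
    rw [cayley_apply h1] at hx
    have h2 : ((-1 : ℝ) • 1 - A) u = ((-1 : ℝ) • 1 - A) 0 := by
      rw [map_zero, ← hx]
      simp only [LinearMap.sub_apply, LinearMap.smul_apply, Module.End.one_apply]
      module
    simp [h1' h2]

attribute [local instance] endTopology end_isModuleTopology end_isTopologicalRing

theorem continuousOn_cayley (ω : LinearMap.BilinForm ℝ H) :
    ContinuousOn (cayley : End ℝ H → End ℝ H) (cayleyDomain ω) := by
  unfold cayley
  refine ContinuousOn.mul (by fun_prop) ?_
  exact continuousOn_ringInverse_end.comp (by fun_prop) fun X hX => isUnit_iff_injective.2 hX.2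

theorem sign_det_one_sub_cayley {X : End ℝ H} (hX : Function.Injective (1 - X : End ℝ H)) :
    SignType.sign (LinearMap.det (1 - cayley X)) = SignType.sign (LinearMap.det (1 - X)) := by
  have h := congrArg LinearMap.det (one_sub_cayley hX)
  rw [map_mul, LinearMap.det_smul, map_one, mul_one] at h
  have hpos : 0 < LinearMap.det (1 - cayley X) * LinearMap.det (1 - X) := by rw [h]; positivity
  rcases pos_and_pos_or_neg_and_neg_of_mul_pos hpos with ⟨h1, h2⟩ | ⟨h1, h2⟩
  · rw [sign_pos h1, sign_pos h2]
  · rw [sign_neg h1, sign_neg h2]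

theorem sigPos_add_sigNeg_skewQuad {ω : LinearMap.BilinForm ℝ H} (hAlt : ω.IsAlt)
    (hNondeg : ω.Nondegenerate) {X : End ℝ H} (hX : X ∈ skewReg ω) :
    sigPos (skewQuad ω X) + sigNeg (skewQuad ω X) = finrank ℝ H := by
  have := QuadraticForm.sigPos_add_sigNeg_add_radical (Q := skewQuad ω X)
  rwa [skewQuad_radical hAlt hNondeg hX, finrank_bot, add_zero] at this

/-- The isometry is `u ↦ (u - X u)/2`; the factor `1/2` makes the two quadratic forms agree exactly.
-/
theorem skewQuad_equivalent {ω : LinearMap.BilinForm ℝ H} (hAlt : ω.IsAlt) {X : End ℝ H}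
    (hX : X ∈ cayleyDomain ω) :
    QuadraticMap.Equivalent (skewQuad ω X) (symmForm ω (cayley X)).toQuadraticMap := by
  have hinj : Function.Injective ((2 : ℝ)⁻¹ • (1 - X) : End ℝ H) := by
    intro x y hxy
    exact hX.2 (smul_right_injective H (inv_ne_zero (two_ne_zero' ℝ)) hxy)
  refine ⟨⟨LinearEquiv.ofInjectiveEndo _ hinj, fun x => ?_⟩⟩
  change symmForm ω (cayley X) ((2 : ℝ)⁻¹ • (x - X x)) ((2 : ℝ)⁻¹ • (x - X x)) = ω (X x) x
  have hx := hX.1.1 x x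
  have h1 := hAlt x
  have h2 := hAlt (X x)
  rw [symmForm_apply, map_smul (cayley X), cayley_apply hX.2]
  simp only [map_smul, map_neg, map_add, map_sub, LinearMap.smul_apply, LinearMap.neg_apply,
    LinearMap.add_apply, LinearMap.sub_apply, smul_eq_mul, h1, h2]
  linarith

/-- The Krein index of a Cayley transform is half the signature of `ω(X x, x)`. -/
theorem two_mul_kreinIndex_cayley {ω : LinearMap.BilinForm ℝ H} (hAlt : ω.IsAlt)
    (hNondeg : ω.Nondegenerate) {X : End ℝ H} (hX : X ∈ cayleyDomain ω) :
    2 * kreinIndex ω (cayley X) = (sigPos (skewQuad ω X) : ℤ) - sigNeg (skewQuad ω X) := by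
  obtain ⟨hA, h1, h1'⟩ := cayley_mem hX
  have he := skewQuad_equivalent hAlt hX
  have hrad : (symmForm ω (cayley X)).toQuadraticMap.radical = ⊥ := by
    have := he.rank_radical_eq
    rw [skewQuad_radical hAlt hNondeg hX.1, finrank_bot] at this
    exact Submodule.finrank_eq_zero.1 this.symm
  have hnegQ : (-symmForm ω (cayley X)).toQuadraticMap = -(symmForm ω (cayley X)).toQuadraticMap :=
    rfl
  have hrad' : (-symmForm ω (cayley X)).toQuadraticMap.radical = ⊥ := by
    rw [eq_bot_iff, ← hrad]
    intro x hx
    rw [hnegQ, QuadraticMap.mem_radical_iff'] at hx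
    rw [QuadraticMap.mem_radical_iff']
    exact ⟨neg_eq_zero.1 hx.1, fun y => neg_inj.1 (hx.2 y)⟩
  rw [two_mul_kreinIndex hAlt hNondeg hA h1 h1', posInertia_sesqExt hrad, he.sigPos_eq,
    he.sigNeg_eq, ← sigPos_neg, ← hnegQ, ← posInertia_sesqExt hrad']
  simp only [sesqExt_neg]

end Cayley

/-! ### Paths of invertible real matrices -/

section MatrixPaths

variable {ι : Type*} [Fintype ι] [DecidableEq ι]

theorem joinedIn_det_mul {A B C D : Matrix ι ι ℝ} (h : JoinedIn {M : Matrix ι ι ℝ | M.det ≠ 0} A B)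
    (h' : JoinedIn {M : Matrix ι ι ℝ | M.det ≠ 0} C D) :
    JoinedIn {M : Matrix ι ι ℝ | M.det ≠ 0} (A * C) (B * D) := by
  refine (h.mul h').mono ?_
  rintro _ ⟨M, hM, N, hN, rfl⟩
  simp only [Set.mem_ofPred_eq, Matrix.det_mul] at hM hN ⊢
  exact mul_ne_zero hM hN

theorem joinedIn_det_transvections (L : List (Matrix.TransvectionStruct ι ℝ)) :
    JoinedIn {M : Matrix ι ι ℝ | M.det ≠ 0}
      (L.map Matrix.TransvectionStruct.toMatrix).prod 1 := by
  induction L with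
  | nil => exact JoinedIn.refl (by simp)
  | cons t L ih =>
    rw [List.map_cons, List.prod_cons, ← mul_one (1 : Matrix ι ι ℝ)]
    refine joinedIn_det_mul (JoinedIn.symm ?_) ih
    refine JoinedIn.ofLine (f := fun s => Matrix.transvection t.i t.j (s * t.c)) ?_ ?_ ?_ ?_
    · refine Continuous.continuousOn (continuous_matrix fun a b => ?_)
      simp only [Matrix.transvection, Matrix.add_apply, Matrix.single_apply]
      split_ifs <;> fun_prop
    · simp
    · simp [Matrix.TransvectionStruct.toMatrix]
    · rintro _ ⟨s, -, rfl⟩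
      simp [Matrix.det_transvection_of_ne _ _ t.hij]

/-- An invertible real matrix can be joined to a diagonal matrix of signs. -/
theorem exists_joinedIn_diagonal_sign {M : Matrix ι ι ℝ} (hM : M.det ≠ 0) :
    ∃ ε : ι → ℝ, (∀ i, ε i * ε i = 1) ∧
      JoinedIn {M : Matrix ι ι ℝ | M.det ≠ 0} M (Matrix.diagonal ε) := by
  -- Gaussian elimination: the transvections contract to `1`, and each diagonal entry slides to its
  -- own sign.
  obtain ⟨L, L', D, rfl⟩ := Matrix.Pivot.exists_list_transvec_mul_diagonal_mul_list_transvec M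
  have hD : ∀ i, D i ≠ 0 := by
    have : (Matrix.diagonal D).det ≠ 0 := fun h => hM (by simp [Matrix.det_mul, h])
    rw [Matrix.det_diagonal] at this
    exact fun i => Finset.prod_ne_zero_iff.1 this i (Finset.mem_univ i)
  refine ⟨fun i => SignType.sign (D i), fun i => ?_, ?_⟩
  · rcases lt_or_gt_of_ne (hD i) with h | h <;> simp [h]
  have h1 := joinedIn_det_transvections L
  have h2 := joinedIn_det_transvections L'
  have h3 : JoinedIn {M : Matrix ι ι ℝ | M.det ≠ 0} (Matrix.diagonal D)
      (Matrix.diagonal fun i => (SignType.sign (D i) : ℝ)) := by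
    refine JoinedIn.ofLine
      (f := fun s : ℝ => Matrix.diagonal fun i => (1 - s) * D i + s * (SignType.sign (D i) : ℝ))
      ?_ ?_ ?_ ?_
    · exact Continuous.continuousOn (by fun_prop)
    · simp
    · simp
    · rintro _ ⟨s, ⟨hs0, hs1⟩, rfl⟩
      simp only [Set.mem_ofPred_eq, Matrix.det_diagonal]
      refine Finset.prod_ne_zero_iff.2 fun i _ => ?_
      rcases lt_or_gt_of_ne (hD i) with h | h
      · simp only [sign_neg h, SignType.coe_neg_one]
        rcases hs0.eq_or_lt with rfl | hs
        · simpa using hD i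
        · nlinarith [mul_nonneg (sub_nonneg.2 hs1) (neg_pos.2 h).le]
      · simp only [sign_pos h, SignType.coe_one]
        rcases hs0.eq_or_lt with rfl | hs
        · simpa using hD i
        · nlinarith [mul_nonneg (sub_nonneg.2 hs1) h.le]
  simpa using joinedIn_det_mul (joinedIn_det_mul h1 h3) h2

end MatrixPaths

/-! ### Signature as the only invariant of `skewReg` -/

section SignatureComponents

variable {H : Type*} [AddCommGroup H] [Module ℝ H] [FiniteDimensional ℝ H]

open QuadraticMap in
/-- Nondegenerate real quadratic forms with equal positive indices are equivalent. -/
theorem equivalent_of_sigPos_eq {Q Q' : QuadraticForm ℝ H} (hQ : Q.radical = ⊥)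
    (hQ' : Q'.radical = ⊥) (h : sigPos Q = sigPos Q') :
    ∃ w : Fin (finrank ℝ H) → ℝ, Equivalent Q (weightedSumSquares ℝ w) ∧
      Equivalent Q' (weightedSumSquares ℝ w) := by
  have sep : ∀ {Q : QuadraticForm ℝ H}, Q.radical = ⊥ →
      (associated (R := ℝ) Q).SeparatingLeft := by
    intro Q hQ x hx
    have hmem : x ∈ Q.radical := by
      rw [mem_radical_iff']
      have h0 : Q x = 0 := by rw [← associated_eq_self_apply ℝ Q x, hx x]
      refine ⟨h0, fun y => ?_⟩
      have := hx y
      rw [associated_apply] at this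
      simp only [h0] at this
      simp at this
      linarith
    rw [hQ] at hmem
    simpa using hmem
  obtain ⟨w, hw, e⟩ := Q.equivalent_one_neg_one_weighted_sum_squared (sep hQ)
  obtain ⟨w', hw', e'⟩ := Q'.equivalent_one_neg_one_weighted_sum_squared (sep hQ')
  rw [QuadraticForm.sigPos_of_equiv_weightedSumSquares e,
    QuadraticForm.sigPos_of_equiv_weightedSumSquares e'] at h
  refine ⟨w, e, e'.trans ?_⟩
  classical
  have hc : Fintype.card {i // 0 < w' i} = Fintype.card {i // 0 < w i} := by
    rw [← Nat.card_eq_fintype_card, ← Nat.card_eq_fintype_card]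
    exact h.symm
  -- All weights are `±1`, so any permutation matching the positive positions matches the weights.
  obtain ⟨σ⟩ : Nonempty ({i // 0 < w' i} ≃ {i // 0 < w i}) := ⟨Fintype.equivOfCardEq hc⟩
  let τ := σ.extendSubtype
  have hτ : ∀ i, w (τ i) = w' i := by
    intro i
    by_cases hi : 0 < w' i
    · have h1 := σ.extendSubtype_mem i hi
      rcases hw' i with h2 | h2 <;> rcases hw (τ i) with h3 | h3 <;> simp_all <;> linarith
    · have h1 := σ.extendSubtype_not_mem i hi
      rcases hw' i with h2 | h2 <;> rcases hw (τ i) with h3 | h3 <;> simp_all <;> linarith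
  refine ⟨⟨LinearEquiv.funCongrLeft ℝ ℝ τ.symm, fun x => ?_⟩⟩
  simp only [weightedSumSquares_apply]
  refine (Fintype.sum_equiv τ _ _ fun i => ?_).symm
  simp [LinearEquiv.funCongrLeft, hτ]

attribute [local instance] endTopology end_isModuleTopology end_isTopologicalRing

theorem joinedIn_det_end {ι : Type*} [Fintype ι] [DecidableEq ι] (v : Basis ι ℝ H)
    {g : End ℝ H} (hg : Function.Injective g) :
    ∃ ε : ι → ℝ, (∀ i, ε i * ε i = 1) ∧
      JoinedIn {g : End ℝ H | Function.Injective g} g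
        (Matrix.toLin v v (Matrix.diagonal ε)) := by
  have hdet : (LinearMap.toMatrix v v g).det ≠ 0 := by
    rw [LinearMap.det_toMatrix]; exact injective_iff_det_ne_zero.1 hg
  obtain ⟨ε, hε, h⟩ := exists_joinedIn_diagonal_sign hdet
  refine ⟨ε, hε, ?_⟩
  have h2 := h.map (continuous_toLin v)
  rw [Matrix.toLin_toMatrix] at h2
  refine h2.mono ?_
  rintro _ ⟨M, hM, rfl⟩
  rw [Set.mem_ofPred_eq, injective_iff_det_ne_zero, LinearMap.det_toLin]
  exact hM

/-- The adjoint with respect to a nondegenerate form, as a linear map. -/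
noncomputable def formAdjoint (ω : LinearMap.BilinForm ℝ H) (hω : ω.Nondegenerate) :
    End ℝ H →ₗ[ℝ] End ℝ H where
  toFun g := (ω.toDual hω).symm.toLinearMap ∘ₗ g.dualMap ∘ₗ (ω.toDual hω).toLinearMap
  map_add' g h := by
    ext x
    simp only [LinearMap.comp_apply, LinearMap.add_apply, LinearEquiv.coe_coe, ← map_add]
    congr 1
    ext y
    simp
  map_smul' c g := by
    ext x
    simp only [LinearMap.comp_apply, LinearMap.smul_apply, LinearEquiv.coe_coe, ← map_smul,
      RingHom.id_apply]
    congr 1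
    ext y
    simp

theorem formAdjoint_apply (ω : LinearMap.BilinForm ℝ H) (hω : ω.Nondegenerate) (g : End ℝ H)
    (x y : H) : ω (formAdjoint ω hω g x) y = ω x (g y) := by
  rw [← LinearMap.BilinForm.toDual_def hω]
  simp only [formAdjoint, LinearMap.coe_mk, AddHom.coe_mk, LinearMap.comp_apply,
    LinearEquiv.coe_coe, LinearEquiv.apply_symm_apply, LinearMap.dualMap_apply]
  rw [LinearMap.BilinForm.toDual_def]

/-- Injective infinitesimally symplectic endomorphisms whose quadratic forms have the same signature
can be joined. -/
theorem joinedIn_skewReg {ω : LinearMap.BilinForm ℝ H} (hAlt : ω.IsAlt)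
    (hω : ω.Nondegenerate) {X X' : End ℝ H} (hX : X ∈ skewReg ω) (hX' : X' ∈ skewReg ω)
    (h : sigPos (skewQuad ω X) = sigPos (skewQuad ω X')) : JoinedIn (skewReg ω) X' X := by
  obtain ⟨w, ⟨e⟩, ⟨e'⟩⟩ := equivalent_of_sigPos_eq (skewQuad_radical hAlt hω hX)
    (skewQuad_radical hAlt hω hX') h
  have symm : ∀ {X : End ℝ H}, X ∈ skewReg ω → ∀ x y, ω (X x) y = ω (X y) x := fun {X} hX x y => by
    rw [hX.1 x y, ← hAlt.neg_eq x]
  let v : Basis (Fin (finrank ℝ H)) ℝ H := (Pi.basisFun ℝ _).map e.toLinearEquiv.symm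
  have polar : ∀ {X : End ℝ H}, X ∈ skewReg ω → ∀ x y, 2 * ω (X x) y =
      skewQuad ω X (x + y) - skewQuad ω X x - skewQuad ω X y := fun {X} hX x y => by
    simp only [skewQuad_apply, map_add, LinearMap.add_apply, symm hX y x]
    ring
  have hpol : ∀ x y, ω (X x) y = ∑ i, w i * (e x i * e y i) := by
    intro x y
    have := polar hX x y
    rw [← e.map_app, ← e.map_app, ← e.map_app] at this
    simp only [QuadraticMap.weightedSumSquares_apply, map_add, Pi.add_apply, smul_eq_mul,
      ← Finset.sum_sub_distrib] at this
    have h2 : ∑ i, (w i * ((e x i + e y i) * (e x i + e y i)) - w i * (e x i * e x i) -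
        w i * (e y i * e y i)) = 2 * ∑ i, w i * (e x i * e y i) := by
      rw [Finset.mul_sum]
      exact Finset.sum_congr rfl fun i _ => by ring
    rw [h2] at this
    linarith
  let g : End ℝ H := (e'.toLinearEquiv.trans e.toLinearEquiv.symm).toLinearMap
  have hg : Function.Injective g := (e'.toLinearEquiv.trans e.toLinearEquiv.symm).injective
  have heg : ∀ x, e (g x) = e' x := fun x => e.toLinearEquiv.apply_symm_apply _
  have hXg : ∀ x y, ω (X (g x)) (g y) = ω (X' x) y := by
    intro x y
    have h1 := polar hX' x y
    have h2 := polar hX (g x) (g y)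
    rw [← e.map_app, ← e.map_app, ← e.map_app, map_add, heg, heg, ← map_add, e'.map_app, e'.map_app,
      e'.map_app, ← h1] at h2
    linarith
  -- `Φ k` represents the form of `X` pulled back along `k`, so a path of invertible `k` gives a
  -- path in `skewReg ω`.
  let Φ : End ℝ H → End ℝ H := fun k => formAdjoint ω hω k * X * k
  have hΦ : ∀ k x y, ω (Φ k x) y = ω (X (k x)) (k y) := fun k x y => by
    simp only [Φ, Module.End.mul_apply, formAdjoint_apply]
  have hΦc : Continuous Φ := by
    have : Continuous (formAdjoint ω hω) := IsModuleTopology.continuous_of_linearMap _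
    exact (this.mul continuous_const).mul continuous_id
  have hext : ∀ {Y Z : End ℝ H}, (∀ x y, ω (Y x) y = ω (Z x) y) → Y = Z := fun {Y Z} hYZ => by
    ext x
    refine sub_eq_zero.1 (hω.1 _ fun y => ?_)
    rw [map_sub, LinearMap.sub_apply, hYZ, sub_self]
  obtain ⟨ε, hε, hj⟩ := joinedIn_det_end v hg
  have h1 : Φ g = X' := hext fun x y => by rw [hΦ, hXg]
  -- Sign changes in a basis diagonalizing the form of `X` preserve that form; hence it does not
  -- matter in which component of `GL` the map `g` lies.
  have h2 : Φ (Matrix.toLin v v (Matrix.diagonal ε)) = X := by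
    have heε : ∀ x i, e (Matrix.toLin v v (Matrix.diagonal ε) x) i = ε i * e x i := by
      intro x i
      have hr : ∀ z, v.repr z = Finsupp.equivFunOnFinite.symm (e z) := by
        intro z
        ext i
        simp [v]
        rfl
      have := congrFun (LinearMap.toMatrix_mulVec_repr v v (Matrix.toLin v v (Matrix.diagonal ε)) x) i
      rw [LinearMap.toMatrix_toLin, Matrix.mulVec_diagonal] at this
      simpa [hr] using this.symm
    refine hext fun x y => ?_
    rw [hΦ, hpol, hpol]
    refine Finset.sum_congr rfl fun i _ => ?_
    rw [heε, heε]
    linear_combination w i * e x i * e y i * hε i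
  have hjoin := hj.map hΦc
  rw [h1, h2] at hjoin
  refine hjoin.mono ?_
  rintro _ ⟨k, hk, rfl⟩
  refine ⟨fun x y => ?_, ?_⟩
  · rw [hΦ, hAlt.neg_eq x, hΦ, symm hX]
  · rw [← LinearMap.ker_eq_bot, LinearMap.ker_eq_bot']
    intro x hx
    have hkx : X (k x) = 0 := by
      refine hω.1 _ fun y => ?_
      obtain ⟨y, rfl⟩ := LinearMap.injective_iff_surjective.1 hk y
      rw [← hΦ, hx]
      simp
    exact hk ((hX.2 (hkx.trans (map_zero X).symm)).trans (map_zero k).symm)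

end SignatureComponents

/-! ### Splitting off and moving hyperbolic planes -/

section PlaneSum

variable {W : Type*} [AddCommGroup W] [Module ℝ W]

/-- The orthogonal sum of the standard symplectic plane and a form. -/
def planeSum (ω : LinearMap.BilinForm ℝ W) : LinearMap.BilinForm ℝ ((ℝ × ℝ) × W) :=
  LinearMap.mk₂ ℝ (fun p q => p.1.1 * q.1.2 - p.1.2 * q.1.1 + ω p.2 q.2)
    (fun p p' q => by simp; ring) (fun c p q => by simp; ring) (fun p q q' => by simp; ring)
    (fun c p q => by simp; ring)

@[simp]
theorem planeSum_apply (ω : LinearMap.BilinForm ℝ W) (p q : (ℝ × ℝ) × W) :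
    planeSum ω p q = p.1.1 * q.1.2 - p.1.2 * q.1.1 + ω p.2 q.2 := rfl

theorem planeSum_isAlt {ω : LinearMap.BilinForm ℝ W} (hAlt : ω.IsAlt) : (planeSum ω).IsAlt := by
  intro p
  rw [planeSum_apply, hAlt p.2]
  ring

theorem nondegenerate_of_isAlt {ω : LinearMap.BilinForm ℝ W} (hAlt : ω.IsAlt)
    (h : ∀ x, (∀ y, ω x y = 0) → x = 0) : ω.Nondegenerate :=
  ⟨h, fun y hy => h y fun x => by rw [← hAlt.neg_eq x, hy x, neg_zero]⟩

theorem planeSum_nondegenerate {ω : LinearMap.BilinForm ℝ W} (hAlt : ω.IsAlt)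
    (hω : ω.Nondegenerate) : (planeSum ω).Nondegenerate := by
  refine nondegenerate_of_isAlt (planeSum_isAlt hAlt) ?_
  rintro ⟨⟨a, b⟩, x⟩ h
  have h1 := h ((0, 1), 0)
  have h2 := h ((1, 0), 0)
  have h3 : x = 0 := hω.1 x fun y => by simpa using h ((0, 0), y)
  simp at h1 h2
  simp [h1, h2, h3]

/-- The endomorphism `diag(c, -c)` of the plane, extended by `Y`. -/
def hypSum (c : ℝ) (Y : End ℝ W) : End ℝ ((ℝ × ℝ) × W) :=
  LinearMap.prodMap (LinearMap.prodMap (c • LinearMap.id) ((-c) • LinearMap.id)) Y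

@[simp]
theorem hypSum_apply (c : ℝ) (Y : End ℝ W) (p : (ℝ × ℝ) × W) :
    hypSum c Y p = ((c * p.1.1, -c * p.1.2), Y p.2) := rfl

theorem hypSum_mem_skewReg {ω : LinearMap.BilinForm ℝ W} {Y : End ℝ W} (hY : Y ∈ skewReg ω) {c : ℝ}
    (hc : c ≠ 0) : hypSum c Y ∈ skewReg (planeSum ω) := by
  refine ⟨fun p q => ?_, ?_⟩
  · simp only [planeSum_apply, hypSum_apply, hY.1 p.2 q.2]
    ring
  · rw [← LinearMap.ker_eq_bot, LinearMap.ker_eq_bot']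
    rintro ⟨⟨a, b⟩, x⟩ h
    simp only [hypSum_apply, Prod.mk_eq_zero, mul_eq_zero, neg_eq_zero, hc, false_or] at h
    obtain ⟨⟨rfl, rfl⟩, h⟩ := h
    rw [hY.2 (h.trans (map_zero Y).symm)]
    rfl

theorem injective_one_sub_hypSum {Y : End ℝ W} (hY : Function.Injective (1 - Y : End ℝ W)) {c : ℝ}
    (hc : c ≠ 1) (hc' : c ≠ -1) : Function.Injective (1 - hypSum c Y : End ℝ ((ℝ × ℝ) × W)) := by
  rw [← LinearMap.ker_eq_bot, LinearMap.ker_eq_bot']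
  rintro ⟨⟨a, b⟩, x⟩ h
  simp only [LinearMap.sub_apply, Module.End.one_apply, hypSum_apply, Prod.mk_sub_mk,
    Prod.mk_eq_zero] at h
  obtain ⟨⟨h1, h2⟩, h3⟩ := h
  have ha : a = 0 := by
    have : (1 - c) * a = 0 := by linarith
    exact (mul_eq_zero.1 this).resolve_left (sub_ne_zero.2 hc.symm)
  have hb : b = 0 := by
    have : (c + 1) * b = 0 := by linarith
    exact (mul_eq_zero.1 this).resolve_left fun h => hc' (by linarith)
  have hx : x = 0 := hY (by simpa using h3)
  simp [ha, hb, hx]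

theorem hypSum_mem {ω : LinearMap.BilinForm ℝ W} {Y : End ℝ W} (hY : Y ∈ cayleyDomain ω) {c : ℝ}
    (h0 : c ≠ 0) (h1 : c ≠ 1) (h1' : c ≠ -1) : hypSum c Y ∈ cayleyDomain (planeSum ω) :=
  ⟨hypSum_mem_skewReg hY.1 h0, injective_one_sub_hypSum hY.2 h1 h1'⟩

theorem det_one_sub_hypSum [FiniteDimensional ℝ W] (c : ℝ) (Y : End ℝ W) :
    LinearMap.det (1 - hypSum c Y) = (1 - c) * (1 + c) * LinearMap.det (1 - Y) := by
  have : (1 - hypSum c Y : End ℝ ((ℝ × ℝ) × W)) =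
      LinearMap.prodMap (LinearMap.prodMap ((1 - c) • LinearMap.id) ((1 + c) • LinearMap.id))
        (1 - Y) := by
    ext <;> simp
  rw [this, LinearMap.det_prodMap, LinearMap.det_prodMap]
  simp

/-- The plane contributes `2 c a b`, of signature `(1, 1)`. The lines through `(1, 1)` and `(1, -1)`
raise the positive and the negative index by at least one, and the total dimension allows no more.
-/
theorem sigPos_skewQuad_hypSum [FiniteDimensional ℝ W] {ω : LinearMap.BilinForm ℝ W}
    (hAlt : ω.IsAlt) (hω : ω.Nondegenerate) {Y : End ℝ W} (hY : Y ∈ skewReg ω) {c : ℝ}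
    (hc : 0 < c) :
    sigPos (skewQuad (planeSum ω) (hypSum c Y)) = sigPos (skewQuad ω Y) + 1 := by
  have hq : ∀ p, skewQuad (planeSum ω) (hypSum c Y) p = 2 * c * (p.1.1 * p.1.2) +
      skewQuad ω Y p.2 := by
    intro p
    simp only [skewQuad_apply, planeSum_apply, hypSum_apply]
    ring
  have key : ∀ (v : ℝ × ℝ), v ≠ 0 → ∀ (Q : QuadraticForm ℝ ((ℝ × ℝ) × W)) (Q' : QuadraticForm ℝ W),
      (∀ (s : ℝ), s ≠ 0 → ∀ x, Q' x < Q (s • v, x)) → (∀ x, Q (0, x) = Q' x) →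
      sigPos Q' + 1 ≤ sigPos Q := by
    intro v hv Q Q' h h0
    obtain ⟨P, hPd, hP⟩ := exists_finrank_eq_sigPos_and_posDef Q'
    have hP0 : ∀ x ∈ P, x ≠ 0 → 0 < Q' x := fun x hx hx0 =>
      hP ⟨x, hx⟩ fun h => hx0 (congrArg Subtype.val h)
    have hpos : (Q.restrict ((Submodule.span ℝ {v}).prod P)).PosDef := by
      rintro ⟨⟨u, x⟩, hu, hx⟩ hne
      obtain ⟨s, rfl⟩ := Submodule.mem_span_singleton.1 hu
      change 0 < Q (s • v, x)
      have hx' : x ∈ P := hx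
      by_cases hs : s = 0
      · subst hs
        rw [zero_smul, h0]
        refine hP0 x hx' ?_
        rintro rfl
        exact hne (Subtype.ext (by simp))
      · refine lt_of_le_of_lt ?_ (h s hs x)
        by_cases hx0 : x = 0
        · simp [hx0]
        · exact (hP0 x hx' hx0).le
    have hle := le_sigPos_of_posDef Q hpos
    rw [← hPd]
    have hfr : finrank ℝ ((Submodule.span ℝ {v}).prod P) = 1 + finrank ℝ P := by
      let E : ((Submodule.span ℝ {v}).prod P) ≃ₗ[ℝ] Submodule.span ℝ {v} × P :=
        { toFun := fun x => (⟨x.1.1, x.2.1⟩, ⟨x.1.2, x.2.2⟩)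
          invFun := fun x => ⟨(x.1, x.2), x.1.2, x.2.2⟩
          map_add' := fun _ _ => rfl
          map_smul' := fun _ _ => rfl
          left_inv := fun _ => rfl
          right_inv := fun _ => rfl }
      rw [E.finrank_eq, finrank_prod, finrank_span_singleton hv]
    omega
  have h1 := key (1, 1) (by simp) (skewQuad (planeSum ω) (hypSum c Y)) (skewQuad ω Y)
    (fun s hs x => by
      rw [hq]
      have : 0 < s * s := mul_self_pos.2 hs
      have := mul_pos hc this
      simp only [Prod.smul_mk, smul_eq_mul, mul_one]
      linarith) (fun x => by rw [hq]; simp)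
  have h2 := key (1, -1) (by simp) (-skewQuad (planeSum ω) (hypSum c Y)) (-skewQuad ω Y)
    (fun s hs x => by
      rw [_root_.neg_apply, _root_.neg_apply, hq]
      have : 0 < s * s := mul_self_pos.2 hs
      have := mul_pos hc this
      simp only [Prod.smul_mk, smul_eq_mul, mul_one]
      linarith) (fun x => by rw [_root_.neg_apply, _root_.neg_apply, hq]; simp)
  rw [sigPos_neg, sigPos_neg] at h2
  have h3 := sigPos_add_sigNeg_skewQuad hAlt hω hY
  have h4 := sigPos_add_sigNeg_skewQuad (planeSum_isAlt hAlt) (planeSum_nondegenerate hAlt hω)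
    (hypSum_mem_skewReg hY hc.ne')
  rw [finrank_prod, finrank_prod, finrank_self] at h4
  omega

attribute [local instance] endTopology end_isModuleTopology end_isTopologicalRing

theorem joinedIn_hypSum [FiniteDimensional ℝ W] {ω : LinearMap.BilinForm ℝ W} {Y Y' : End ℝ W}
    (h : JoinedIn (cayleyDomain ω) Y Y') {c : ℝ} (h0 : c ≠ 0) (h1 : c ≠ 1) (h1' : c ≠ -1) :
    JoinedIn (cayleyDomain (planeSum ω)) (hypSum c Y) (hypSum c Y') := by
  let L : End ℝ W →ₗ[ℝ] End ℝ ((ℝ × ℝ) × W) :=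
    { toFun := fun Y => LinearMap.prodMap 0 Y
      map_add' := fun Y Y' => by ext <;> simp
      map_smul' := fun r Y => by ext <;> simp }
  have hL : ∀ Y, hypSum c Y = hypSum c 0 + L Y := fun Y => by
    ext <;> simp [L]
  have hcont : Continuous (hypSum c : End ℝ W → End ℝ ((ℝ × ℝ) × W)) := by
    rw [funext hL]
    exact continuous_const.add (IsModuleTopology.continuous_of_linearMap L)
  refine (h.map hcont).mono ?_
  rintro _ ⟨Y, hY, rfl⟩
  exact hypSum_mem hY h0 h1 h1'

/-- Two hyperbolic planes with eigenvalue `2` can be moved to eigenvalue `1 / 2`. -/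
theorem joinedIn_hypSum_hypSum [FiniteDimensional ℝ W] {ω : LinearMap.BilinForm ℝ W} {Z : End ℝ W}
    (hZ : Z ∈ cayleyDomain ω) :
    JoinedIn (cayleyDomain (planeSum (planeSum ω))) (hypSum 2 (hypSum 2 Z))
      (hypSum (1 / 2) (hypSum (1 / 2) Z)) := by
  -- `R` rotates the two planes into each other and is infinitesimally symplectic. Adding `v R` to
  -- eigenvalues `±u` gives `u ± i v` and `-u ± i v`.
  let R : End ℝ ((ℝ × ℝ) × (ℝ × ℝ) × W) :=
    { toFun := fun p => ((-p.2.1.1, -p.2.1.2), ((p.1.1, p.1.2), 0))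
      map_add' := fun p q => by ext <;> simp <;> ring
      map_smul' := fun r p => by ext <;> simp }
  have hR : ∀ p, R p = ((-p.2.1.1, -p.2.1.2), ((p.1.1, p.1.2), 0)) := fun _ => rfl
  let F : ℝ → End ℝ ((ℝ × ℝ) × (ℝ × ℝ) × W) := fun t =>
    (1 - t) • hypSum 2 (hypSum 2 Z) + t • hypSum (1 / 2) (hypSum (1 / 2) Z) + (t * (1 - t)) • R
  have hF : ∀ t p, F t p = (((2 - 3 / 2 * t) * p.1.1 - t * (1 - t) * p.2.1.1,
      -(2 - 3 / 2 * t) * p.1.2 - t * (1 - t) * p.2.1.2),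
      ((t * (1 - t) * p.1.1 + (2 - 3 / 2 * t) * p.2.1.1,
        t * (1 - t) * p.1.2 - (2 - 3 / 2 * t) * p.2.1.2), Z p.2.2)) := by
    intro t p
    simp only [F, LinearMap.add_apply, LinearMap.smul_apply, hypSum_apply, hR]
    ext <;> simp <;> (try ring1)
    module
  refine JoinedIn.ofLine (f := F) ?_ (by simp [F]) (by simp [F]) ?_
  · exact Continuous.continuousOn (by fun_prop)
  rintro _ ⟨t, ⟨ht0, ht1⟩, rfl⟩
  set u := 2 - 3 / 2 * t with hu
  set v := t * (1 - t) with hv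
  have hv0 : 0 ≤ v := mul_nonneg ht0 (by linarith)
  have hu0 : 0 < u := by linarith
  -- The real part `u` equals `1` only at `t = 2/3`, where `v = 2/9`, so the eigenvalue `1` is
  -- avoided.
  have hne : (1 - u) ^ 2 + v ^ 2 ≠ 0 := by
    intro h
    have h1 : 1 - u = 0 := by nlinarith [sq_nonneg (1 - u), sq_nonneg v]
    have h2 : v = 0 := by nlinarith [sq_nonneg (1 - u), sq_nonneg v]
    have : t = 2 / 3 := by linarith
    rw [hv, this] at h2
    norm_num at h2
  refine ⟨⟨fun p q => ?_, ?_⟩, ?_⟩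
  · rw [hF, hF]
    simp only [planeSum_apply, hZ.1.1 p.2.2 q.2.2]
    ring
  · rw [← LinearMap.ker_eq_bot, LinearMap.ker_eq_bot']
    rintro ⟨⟨a, b⟩, ⟨c, d⟩, x⟩ h
    rw [hF] at h
    simp only [Prod.mk_eq_zero] at h
    obtain ⟨⟨h1, h2⟩, ⟨h3, h4⟩, h5⟩ := h
    have hpos : u ^ 2 + v ^ 2 ≠ 0 := by positivity
    have ha : a = 0 := (mul_eq_zero.1 (show (u ^ 2 + v ^ 2) * a = 0 by
      linear_combination u * h1 + v * h3)).resolve_left hpos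
    have hc : c = 0 := (mul_eq_zero.1 (show (u ^ 2 + v ^ 2) * c = 0 by
      linear_combination u * h3 - v * h1)).resolve_left hpos
    have hb : b = 0 := (mul_eq_zero.1 (show (u ^ 2 + v ^ 2) * b = 0 by
      linear_combination -u * h2 + v * h4)).resolve_left hpos
    have hd : d = 0 := (mul_eq_zero.1 (show (u ^ 2 + v ^ 2) * d = 0 by
      linear_combination -u * h4 - v * h2)).resolve_left hpos
    have hx : x = 0 := hZ.1.2 (h5.trans (map_zero Z).symm)
    simp [ha, hb, hc, hd, hx]
  · rw [← LinearMap.ker_eq_bot, LinearMap.ker_eq_bot']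
    rintro ⟨⟨a, b⟩, ⟨c, d⟩, x⟩ h
    rw [LinearMap.sub_apply, hF] at h
    simp only [Module.End.one_apply, Prod.mk_sub_mk, Prod.mk_eq_zero] at h
    obtain ⟨⟨h1, h2⟩, ⟨h3, h4⟩, h5⟩ := h
    have hpos : (1 + u) ^ 2 + v ^ 2 ≠ 0 := by positivity
    have ha : a = 0 := (mul_eq_zero.1 (show ((1 - u) ^ 2 + v ^ 2) * a = 0 by
      linear_combination (1 - u) * h1 - v * h3)).resolve_left hne
    have hc : c = 0 := (mul_eq_zero.1 (show ((1 - u) ^ 2 + v ^ 2) * c = 0 by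
      linear_combination (1 - u) * h3 + v * h1)).resolve_left hne
    have hb : b = 0 := (mul_eq_zero.1 (show ((1 + u) ^ 2 + v ^ 2) * b = 0 by
      linear_combination (1 + u) * h2 - v * h4)).resolve_left hpos
    have hd : d = 0 := (mul_eq_zero.1 (show ((1 + u) ^ 2 + v ^ 2) * d = 0 by
      linear_combination (1 + u) * h4 + v * h2)).resolve_left hpos
    have hx : x = 0 := hZ.2 (by simpa using h5)
    simp [ha, hb, hc, hd, hx]

/-- An element of the Cayley domain with an eigenvector `e` of eigenvalue `μ > 1` in the plane can be
joined to a hyperbolic sum. -/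
theorem exists_joinedIn_hypSum [FiniteDimensional ℝ W] {ω : LinearMap.BilinForm ℝ W}
    {X : End ℝ ((ℝ × ℝ) × W)} (hX : X ∈ cayleyDomain (planeSum ω)) {μ : ℝ}
    (hμ : 1 < μ) (he : X ((1, 0), 0) = ((μ, 0), 0)) :
    ∃ Y ∈ cayleyDomain ω, JoinedIn (cayleyDomain (planeSum ω)) X (hypSum 2 Y) := by
  let Y : End ℝ W := LinearMap.snd ℝ (ℝ × ℝ) W ∘ₗ X ∘ₗ LinearMap.inr ℝ (ℝ × ℝ) W
  have hYdef : ∀ x, Y x = (X ((0, 0), x)).2 := fun _ => rfl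
  -- Skewness against the eigenvector shows that `X` preserves its orthogonal hyperplane; there `X`
  -- is block triangular with diagonal blocks `μ` and `Y`.
  have hsnd : ∀ p, (X p).1.2 = -μ * p.1.2 := by
    intro p
    have := hX.1.1 ((1, 0), 0) p
    rw [he] at this
    simp at this
    linarith
  have hdec : ∀ a x, X ((a, 0), x) = ((μ * a + (X ((0, 0), x)).1.1, 0), Y x) := by
    intro a x
    have : (((a, 0), x) : (ℝ × ℝ) × W) = a • ((1, 0), 0) + ((0, 0), x) := by simp
    rw [this, map_add, map_smul, he]
    ext <;> simp [hYdef, hsnd]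
    ring
  have hskew : Y ∈ skewEnd ω := by
    intro x y
    have := hX.1.1 ((0, 0), x) ((0, 0), y)
    simpa [hYdef] using this
  have hYi : Function.Injective Y := by
    rw [← LinearMap.ker_eq_bot, LinearMap.ker_eq_bot']
    intro x hx
    -- The first coordinate is chosen to cancel the off-diagonal term, lifting a kernel vector of
    -- `Y` to one of `X`; the same correction with `μ - 1` serves `1 - Y`.
    have h0 : X ((-(X ((0, 0), x)).1.1 / μ, 0), x) = X 0 := by
      rw [hdec, hx, map_zero, mul_div_cancel₀ _ (by linarith : μ ≠ 0)]
      simp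
    have := congrArg Prod.snd (hX.1.2 h0)
    simpa using this
  have hY1 : Function.Injective (1 - Y : End ℝ W) := by
    rw [← LinearMap.ker_eq_bot, LinearMap.ker_eq_bot']
    intro x hx
    have hx' : Y x = x := by
      have : x - Y x = 0 := hx
      exact (sub_eq_zero.1 this).symm
    have hμ1 : μ - 1 ≠ 0 := by linarith
    have h0 : (1 - X) ((-(X ((0, 0), x)).1.1 / (μ - 1), 0), x) = (1 - X) 0 := by
      have hd := hdec (-(X ((0, 0), x)).1.1 / (μ - 1)) x
      rw [map_zero, LinearMap.sub_apply, Module.End.one_apply, hd, hx']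
      generalize (X ((0, 0), x)).1.1 = r
      ext
      · simp only [Prod.fst_sub, Prod.fst_zero]
        field_simp
        ring
      · simp
      · simp
    have := congrArg Prod.snd (hX.2 h0)
    simpa using this
  refine ⟨Y, ⟨⟨hskew, hYi⟩, hY1⟩, ?_⟩
  -- The segment keeps the triangular shape with `Y` fixed, while the eigenvalues on the plane are
  -- `±ν` with `ν` between `μ` and `2`, hence `ν > 1`.
  refine JoinedIn.ofLine (f := fun t => (1 - t) • X + t • hypSum 2 Y) ?_ (by simp) (by simp) ?_
  · exact Continuous.continuousOn (by fun_prop)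
  rintro _ ⟨t, ⟨ht0, ht1⟩, rfl⟩
  have hν : 1 < (1 - t) * μ + t * 2 := by
    rcases ht0.eq_or_lt with rfl | ht
    · linarith
    · nlinarith [mul_nonneg (sub_nonneg.2 ht1) (sub_pos.2 hμ).le]
  have hX0 : X ((0, 0), (0 : W)) = 0 := map_zero X
  set ν := (1 - t) * μ + t * 2 with hνdef
  have hsnd' : ∀ p, (((1 - t) • X + t • hypSum 2 Y) p).1.2 = -ν * p.1.2 := by
    intro p
    simp [hsnd, hνdef]
    ring
  have hdec' : ∀ a x, ((1 - t) • X + t • hypSum 2 Y) ((a, 0), x) =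
      ((ν * a + (1 - t) * (X ((0, 0), x)).1.1, 0), Y x) := by
    intro a x
    rw [LinearMap.add_apply, LinearMap.smul_apply, LinearMap.smul_apply, hdec, hypSum_apply]
    ext
    · simp [hνdef]; ring
    · simp
    · simp; module
  refine ⟨⟨fun p q => ?_, ?_⟩, ?_⟩
  · have h1 := hX.1.1 p q
    have h2 := (hypSum_mem_skewReg ⟨hskew, hYi⟩ (two_ne_zero' ℝ)).1 p q
    simp only [LinearMap.add_apply, LinearMap.smul_apply, map_add, map_smul, h1, h2, smul_eq_mul]
    ring
  · rw [← LinearMap.ker_eq_bot, LinearMap.ker_eq_bot']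
    rintro ⟨⟨a, b⟩, x⟩ h
    have hb : b = 0 := by
      have := hsnd' ((a, b), x)
      rw [h] at this
      simp at this
      rcases this with h | h
      · linarith
      · exact h
    subst hb
    rw [hdec'] at h
    simp only [Prod.mk_eq_zero, and_true] at h
    have hx : x = 0 := hYi (h.2.trans (map_zero Y).symm)
    subst hx
    have ha : a = 0 := by
      have := h.1
      simp [hX0] at this
      rcases this with h | h
      · linarith
      · exact h
    simp [ha]
  · rw [← LinearMap.ker_eq_bot, LinearMap.ker_eq_bot']
    rintro ⟨⟨a, b⟩, x⟩ h
    rw [LinearMap.sub_apply, sub_eq_zero, Module.End.one_apply] at h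
    have hb : b = 0 := by
      have := hsnd' ((a, b), x)
      rw [← h] at this
      simp only at this
      have h2 : (1 + ν) * b = 0 := by linarith
      exact (mul_eq_zero.1 h2).resolve_left (by linarith)
    subst hb
    rw [hdec'] at h
    simp only [Prod.mk.injEq, and_true] at h
    have hx : x = 0 := hY1 (by simpa [sub_eq_zero] using h.2)
    subst hx
    have ha : a = 0 := by
      have := h.1
      simp [hX0] at this
      have h2 : (1 - ν) * a = 0 := by linarith
      exact (mul_eq_zero.1 h2).resolve_left (by linarith)
    simp [ha]

end PlaneSum

/-! ### Transport along symplectic isometries and symplectic splittings -/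

section Isometries

variable {H K : Type*} [AddCommGroup H] [Module ℝ H] [AddCommGroup K] [Module ℝ K]
  {ω : LinearMap.BilinForm ℝ H} {ω' : LinearMap.BilinForm ℝ K}

/-- The injective infinitesimally symplectic endomorphisms without real eigenvalues `≥ 1`. These can
be scaled down within the Cayley domain. -/
def shrinkable (ω : LinearMap.BilinForm ℝ H) : Set (End ℝ H) :=
  {X | X ∈ skewReg ω ∧ ∀ t : ℝ, 0 < t → t ≤ 1 → Function.Injective (1 - t • X : End ℝ H)}

theorem shrinkable_subset_cayleyDomain : shrinkable ω ⊆ cayleyDomain ω := fun X hX =>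
  ⟨hX.1, by simpa using hX.2 1 one_pos le_rfl⟩

theorem smul_mem_skewReg {X : End ℝ H} (hX : X ∈ skewReg ω) {t : ℝ} (ht : t ≠ 0) :
    t • X ∈ skewReg ω :=
  ⟨fun x y => by simp [hX.1 x y], fun _ _ h => hX.2 (smul_right_injective H ht h)⟩

theorem hypSum_mem_shrinkable {Y : End ℝ H} (hY : Y ∈ shrinkable ω) {c : ℝ} (h0 : 0 < c)
    (h1 : c < 1) : hypSum c Y ∈ shrinkable (planeSum ω) := by
  refine ⟨hypSum_mem_skewReg hY.1 h0.ne', fun t ht0 ht1 => ?_⟩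
  have : t • hypSum c Y = hypSum (t * c) (t • Y) := by
    ext <;> simp
  rw [this]
  have h2 : t * c < 1 := by nlinarith
  have h3 : 0 < t * c := mul_pos ht0 h0
  exact injective_one_sub_hypSum (hY.2 t ht0 ht1) h2.ne (by linarith)

variable {φ : H ≃ₗ[ℝ] K}

theorem symm_conj_conj (X : End ℝ H) : φ.symm.conj (φ.conj X) = X := by
  ext x
  simp [LinearEquiv.conj_apply]

theorem one_sub_smul_conj (t : ℝ) (X : End ℝ H) :
    (1 - t • φ.conj X : End ℝ K) = φ.conj (1 - t • X) := by
  ext x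
  simp [LinearEquiv.conj_apply]

theorem one_sub_conj (X : End ℝ H) : (1 - φ.conj X : End ℝ K) = φ.conj (1 - X) := by
  simpa using one_sub_smul_conj (φ := φ) 1 X

theorem injective_conj {X : End ℝ H} (hX : Function.Injective X) : Function.Injective (φ.conj X) := by
  rw [LinearEquiv.conj_apply]
  exact (φ.injective.comp hX).comp φ.symm.injective

theorem conj_mem_skewReg (hφ : ∀ x y, ω' (φ x) (φ y) = ω x y) {X : End ℝ H} (hX : X ∈ skewReg ω) :
    φ.conj X ∈ skewReg ω' := by
  refine ⟨fun x y => ?_, injective_conj hX.2⟩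
  obtain ⟨x, rfl⟩ := φ.surjective x
  obtain ⟨y, rfl⟩ := φ.surjective y
  simp [LinearEquiv.conj_apply, hφ, hX.1 x y]

theorem conj_mem_cayleyDomain (hφ : ∀ x y, ω' (φ x) (φ y) = ω x y) {X : End ℝ H}
    (hX : X ∈ cayleyDomain ω) : φ.conj X ∈ cayleyDomain ω' :=
  ⟨conj_mem_skewReg hφ hX.1, by rw [one_sub_conj]; exact injective_conj hX.2⟩

theorem conj_mem_shrinkable (hφ : ∀ x y, ω' (φ x) (φ y) = ω x y) {X : End ℝ H}
    (hX : X ∈ shrinkable ω) : φ.conj X ∈ shrinkable ω' :=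
  ⟨conj_mem_skewReg hφ hX.1, fun t h0 h1 => by
    rw [one_sub_smul_conj]; exact injective_conj (hX.2 t h0 h1)⟩

theorem isometry_symm (hφ : ∀ x y, ω' (φ x) (φ y) = ω x y) (x y : K) :
    ω (φ.symm x) (φ.symm y) = ω' x y := by
  rw [← hφ, φ.apply_symm_apply, φ.apply_symm_apply]

theorem sigPos_skewQuad_conj (hφ : ∀ x y, ω' (φ x) (φ y) = ω x y) (X : End ℝ H) :
    sigPos (skewQuad ω' (φ.conj X)) = sigPos (skewQuad ω X) := by
  refine (QuadraticMap.Equivalent.sigPos_eq ⟨⟨φ, fun x => ?_⟩⟩).symm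
  change ω' (φ.conj X (φ x)) (φ x) = ω (X x) x
  simp [LinearEquiv.conj_apply, hφ]

theorem det_one_sub_conj (X : End ℝ H) :
    LinearMap.det (1 - φ.conj X) = LinearMap.det (1 - X) := by
  rw [one_sub_conj, LinearEquiv.conj_apply, LinearMap.comp_assoc]
  exact LinearMap.det_conj _ φ

attribute [local instance] endTopology end_isModuleTopology end_isTopologicalRing

theorem joinedIn_conj [FiniteDimensional ℝ K] (hφ : ∀ x y, ω' (φ x) (φ y) = ω x y) {X X' : End ℝ H}
    (h : JoinedIn (cayleyDomain ω) X X') :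
    JoinedIn (cayleyDomain ω') (φ.conj X) (φ.conj X') := by
  have hc : Continuous (φ.conj : End ℝ H → End ℝ K) :=
    IsModuleTopology.continuous_of_linearMap φ.conj.toLinearMap
  refine (h.map hc).mono ?_
  rintro _ ⟨X, hX, rfl⟩
  exact conj_mem_cayleyDomain hφ hX

/-- A hyperbolic pair splits off a symplectic plane. -/
theorem exists_planeSum_isometry (hAlt : ω.IsAlt) (hω : ω.Nondegenerate) {e f : H}
    (hef : ω e f = 1) :
    ∃ (W : Submodule ℝ H) (η : LinearMap.BilinForm ℝ W) (φ : H ≃ₗ[ℝ] (ℝ × ℝ) × W), η.IsAlt ∧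
      η.Nondegenerate ∧ (∀ x y, planeSum η (φ x) (φ y) = ω x y) ∧ φ e = ((1, 0), 0) ∧
        φ f = ((0, 1), 0) := by
  have hfe : ω f e = -1 := by rw [← hAlt.neg_eq e, hef]
  let W : Submodule ℝ H := LinearMap.ker (ω e) ⊓ LinearMap.ker (ω f)
  have hWe : ∀ w ∈ W, ω e w = 0 := fun w hw => hw.1
  have hWf : ∀ w ∈ W, ω f w = 0 := fun w hw => hw.2
  have hWe' : ∀ w ∈ W, ω w e = 0 := fun w hw => by rw [← hAlt.neg_eq e, hWe w hw, neg_zero]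
  have hWf' : ∀ w ∈ W, ω w f = 0 := fun w hw => by rw [← hAlt.neg_eq f, hWf w hw, neg_zero]
  have hπ : ∀ x, x - (-ω f x) • e - (ω e x) • f ∈ W := by
    intro x
    refine Submodule.mem_inf.2 ⟨?_, ?_⟩ <;> rw [LinearMap.mem_ker] <;> simp [hAlt e, hAlt f, hef, hfe]
  let φ : H ≃ₗ[ℝ] (ℝ × ℝ) × W :=
    { toFun := fun x => ((-ω f x, ω e x), ⟨x - (-ω f x) • e - (ω e x) • f, hπ x⟩)
      map_add' := fun x y => by
        ext
        · simp; ring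
        · simp
        · simp; module
      map_smul' := fun c x => by
        ext
        · simp
        · simp
        · simp; module
      invFun := fun p => p.1.1 • e + p.1.2 • f + (p.2 : H)
      left_inv := fun x => by simp
      right_inv := fun p => by
        ext
        · simp [hAlt f, hfe, hWf p.2 p.2.2]
        · simp [hAlt e, hef, hWe p.2 p.2.2]
        · simp [hAlt e, hAlt f, hef, hfe, hWe p.2 p.2.2, hWf p.2 p.2.2]
          abel }
  have hφs : ∀ p : (ℝ × ℝ) × W, φ.symm p = p.1.1 • e + p.1.2 • f + (p.2 : H) := fun _ => rfl
  have hηAlt : (ω.restrict W).IsAlt := fun x => hAlt x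
  have hiso' : ∀ p q : (ℝ × ℝ) × W, ω (φ.symm p) (φ.symm q) = planeSum (ω.restrict W) p q := by
    intro p q
    rw [hφs, hφs, planeSum_apply]
    simp only [map_add, map_smul, LinearMap.add_apply, LinearMap.smul_apply, smul_eq_mul, hAlt e,
      hAlt f, hef, hfe, hWe q.2 q.2.2, hWf q.2 q.2.2, hWe' p.2 p.2.2, hWf' p.2 p.2.2]
    change _ = _ + ω p.2 q.2
    ring
  refine ⟨W, ω.restrict W, φ, hηAlt, ?_, ?_, ?_, ?_⟩
  · refine nondegenerate_of_isAlt hηAlt fun x hx => ?_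
    have h0 : φ.symm ((0, 0), x) = 0 := by
      refine hω.1 _ fun y => ?_
      obtain ⟨q, rfl⟩ := φ.symm.surjective y
      rw [hiso', planeSum_apply]
      simpa using hx q.2
    have := congrArg Prod.snd ((φ.symm.map_eq_zero_iff).1 h0)
    simpa using this
  · intro x y
    rw [← hiso', φ.symm_apply_apply, φ.symm_apply_apply]
  · rw [← LinearEquiv.eq_symm_apply]
    simp [hφs]
  · rw [← LinearEquiv.eq_symm_apply]
    simp [hφs]

theorem exists_apply_eq_one (hω : ω.Nondegenerate) {e : H} (he : e ≠ 0) : ∃ f, ω e f = 1 := by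
  by_contra! h
  refine he (hω.1 e fun y => ?_)
  by_contra hy
  exact h ((ω e y)⁻¹ • y) (by simp [hy])

theorem exists_eigenvector_of_not_injective {X : End ℝ H} {t : ℝ} (ht0 : 0 < t)
    (ht : ¬ Function.Injective (1 - t • X : End ℝ H)) : ∃ e, e ≠ 0 ∧ X e = t⁻¹ • e := by
  rw [← LinearMap.ker_eq_bot, LinearMap.ker_eq_bot'] at ht
  push Not at ht
  obtain ⟨e, he, he0⟩ := ht
  have h1 : e - t • X e = 0 := he
  exact ⟨e, he0, by rw [eq_inv_smul_iff₀ ht0.ne', ← sub_eq_zero.1 h1]⟩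

end Isometries

/-! ### Removing real eigenvalues greater than one -/

section Induction

attribute [local instance] endTopology end_isModuleTopology end_isTopologicalRing

variable {H : Type*} [AddCommGroup H] [Module ℝ H] [FiniteDimensional ℝ H]
  {ω : LinearMap.BilinForm ℝ H}

theorem sign_det_eq_of_joinedIn {X X' : End ℝ H} (h : JoinedIn (cayleyDomain ω) X X') :
    SignType.sign (LinearMap.det (1 - X)) = SignType.sign (LinearMap.det (1 - X')) := by
  obtain ⟨γ, hγ⟩ := h
  have hc : Continuous fun t => LinearMap.det (1 - γ t) :=
    continuous_linearMap_det.comp (continuous_const.sub γ.continuous)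
  have hs : Continuous fun t => SignType.sign (LinearMap.det (1 - γ t)) :=
    continuous_iff_continuousAt.2 fun t =>
      ContinuousAt.comp (g := SignType.sign) (f := fun t => LinearMap.det (1 - γ t))
        (continuousAt_sign_of_ne_zero (injective_iff_det_ne_zero.1 (hγ t).2)) hc.continuousAt
  have := PreconnectedSpace.constant inferInstance hs (x := 0) (y := 1)
  simpa using this

/-- In a splitting adapted to an eigenvector with eigenvalue `> 1`, a map can be joined to a
hyperbolic sum. -/
theorem exists_joinedIn_conj_hypSum {W : Type*} [AddCommGroup W] [Module ℝ W]
    [FiniteDimensional ℝ W] {η : LinearMap.BilinForm ℝ W} {φ : H ≃ₗ[ℝ] (ℝ × ℝ) × W}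
    (hφ : ∀ x y, planeSum η (φ x) (φ y) = ω x y) {e : H} (hφe : φ e = ((1, 0), 0)) {X : End ℝ H}
    (hX : X ∈ cayleyDomain ω) {μ : ℝ} (hμ : 1 < μ) (hXe : X e = μ • e) :
    ∃ Y ∈ cayleyDomain η, JoinedIn (cayleyDomain ω) X (φ.symm.conj (hypSum 2 Y)) := by
  obtain ⟨Y, hY, hj⟩ := exists_joinedIn_hypSum (conj_mem_cayleyDomain hφ hX) hμ (by
      rw [LinearEquiv.conj_apply_apply, ← hφe, φ.symm_apply_apply, hXe, map_smul, hφe]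
      simp)
  refine ⟨Y, hY, ?_⟩
  have := joinedIn_conj (isometry_symm hφ) hj
  rwa [symm_conj_conj] at this

/-- If `1 - t X` is singular for some `t ∈ (0, 1)`, then `X` can be joined to a map with a hyperbolic
plane of eigenvalues `±2`. -/
theorem exists_splitting_of_not_injective (hAlt : ω.IsAlt) (hω : ω.Nondegenerate) {X : End ℝ H}
    (hX : X ∈ cayleyDomain ω) {t : ℝ} (ht0 : 0 < t) (ht1 : t < 1)
    (ht : ¬ Function.Injective (1 - t • X : End ℝ H)) :
    ∃ (W : Submodule ℝ H) (η : LinearMap.BilinForm ℝ W) (φ : H ≃ₗ[ℝ] (ℝ × ℝ) × W), η.IsAlt ∧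
      η.Nondegenerate ∧ (∀ x y, planeSum η (φ x) (φ y) = ω x y) ∧
        ∃ Y ∈ cayleyDomain η, JoinedIn (cayleyDomain ω) X (φ.symm.conj (hypSum 2 Y)) := by
  obtain ⟨e, he0, hXe⟩ := exists_eigenvector_of_not_injective ht0 ht
  obtain ⟨f, hf⟩ := exists_apply_eq_one hω he0
  obtain ⟨W, η, φ, hη, hη', hφ, hφe, -⟩ := exists_planeSum_isometry hAlt hω hf
  exact ⟨W, η, φ, hη, hη', hφ,
    exists_joinedIn_conj_hypSum hφ hφe hX ((one_lt_inv₀ ht0).2 ht1) hXe⟩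

/-- `det (1 - t X)` equals `1` at `t = 0` and is negative at `t = 1`; a zero `t` in between yields
the eigenvalue `t⁻¹ > 1`. -/
theorem exists_not_injective_of_det_neg {X : End ℝ H} (h : LinearMap.det (1 - X) < 0) :
    ∃ t : ℝ, 0 < t ∧ t < 1 ∧ ¬ Function.Injective (1 - t • X : End ℝ H) := by
  have hc : Continuous fun t : ℝ => LinearMap.det (1 - t • X) :=
    continuous_linearMap_det.comp (by fun_prop)
  obtain ⟨t, ⟨h0, h1⟩, ht⟩ := intermediate_value_Ioo' (zero_le_one' ℝ) hc.continuousOn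
    (show (0 : ℝ) ∈ Set.Ioo _ _ by simpa using h)
  exact ⟨t, h0, h1, fun hi => injective_iff_det_ne_zero.1 hi ht⟩

theorem sign_det_of_joinedIn_conj_hypSum {W : Type*} [AddCommGroup W] [Module ℝ W]
    [FiniteDimensional ℝ W] {φ : H ≃ₗ[ℝ] (ℝ × ℝ) × W} {X : End ℝ H} {Y : End ℝ W}
    (hj : JoinedIn (cayleyDomain ω) X (φ.symm.conj (hypSum 2 Y))) :
    SignType.sign (LinearMap.det (1 - X)) = -SignType.sign (LinearMap.det (1 - Y)) := by
  rw [sign_det_eq_of_joinedIn hj, det_one_sub_conj, det_one_sub_hypSum, sign_mul,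
    sign_neg (by norm_num : (1 - 2 : ℝ) * (1 + 2) < 0)]
  simp

/-- An eigenvalue `> 1` splits off a plane whose factor of `det (1 - X)` is negative, so the
complement has negative determinant and splits off another. The remainder, of dimension smaller by
four, is handled by induction, and the two planes move together from `2` to `1/2`. -/
theorem exists_joinedIn_shrinkable_aux (n : ℕ) : ∀ {H : Type*} [AddCommGroup H] [Module ℝ H]
    [FiniteDimensional ℝ H] {ω : LinearMap.BilinForm ℝ H}, ω.IsAlt → ω.Nondegenerate →
    finrank ℝ H ≤ n → ∀ {X : End ℝ H}, X ∈ cayleyDomain ω → 0 < LinearMap.det (1 - X) →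
    ∃ X' ∈ shrinkable ω, JoinedIn (cayleyDomain ω) X X' := by
  induction n using Nat.strong_induction_on with
  | _ n ih =>
  intro H _ _ _ ω hAlt hω hn X hX hdet
  by_cases hall : ∀ t : ℝ, 0 < t → t ≤ 1 → Function.Injective (1 - t • X : End ℝ H)
  · exact ⟨X, ⟨hX.1, hall⟩, JoinedIn.refl hX⟩
  push Not at hall
  obtain ⟨t, ht0, ht1, ht⟩ := hall
  have ht1' : t < 1 := lt_of_le_of_ne ht1 fun h => ht (by rw [h, one_smul]; exact hX.2)
  obtain ⟨W, η, φ, hη, hη', hφ, Y, hY, hj⟩ := exists_splitting_of_not_injective hAlt hω hX ht0 ht1' ht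
  have hYdet : LinearMap.det (1 - Y) < 0 := by
    have := sign_det_of_joinedIn_conj_hypSum hj
    rw [sign_pos hdet] at this
    rw [← sign_eq_neg_one_iff, ← neg_inj, ← this, neg_neg]
  obtain ⟨s, hs0, hs1, hs⟩ := exists_not_injective_of_det_neg hYdet
  obtain ⟨W', η', ψ, hθ, hθ', hψ, Z, hZ, hj'⟩ :=
    exists_splitting_of_not_injective hη hη' hY hs0 hs1 hs
  have hZdet : 0 < LinearMap.det (1 - Z) := by
    have := sign_det_of_joinedIn_conj_hypSum hj'
    rw [sign_neg hYdet] at this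
    exact sign_eq_one_iff.1 (neg_inj.1 this).symm
  have hd1 : finrank ℝ H = 2 + finrank ℝ W := by
    rw [φ.finrank_eq, finrank_prod, finrank_prod, finrank_self]
  have hd2 : finrank ℝ W = 2 + finrank ℝ W' := by
    rw [ψ.finrank_eq, finrank_prod, finrank_prod, finrank_self]
  obtain ⟨Z', hZ', hjZ⟩ := ih (finrank ℝ W') (by omega) hθ hθ' le_rfl hZ hZdet
  have hZc := shrinkable_subset_cayleyDomain hZ'
  let Ψ : ((ℝ × ℝ) × W) ≃ₗ[ℝ] (ℝ × ℝ) × (ℝ × ℝ) × W' := (LinearEquiv.refl ℝ (ℝ × ℝ)).prodCongr ψ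
  have hΨ : ∀ x y, planeSum (planeSum η') (Ψ x) (Ψ y) = planeSum η x y := by
    intro x y
    rw [planeSum_apply (planeSum η'), planeSum_apply η]
    change _ + planeSum η' (ψ x.2) (ψ y.2) = _
    rw [hψ]
    rfl
  have hconj : ∀ (U : End ℝ ((ℝ × ℝ) × W')) (c : ℝ),
      hypSum c (ψ.symm.conj U) = Ψ.symm.conj (hypSum c U) := by
    intro U c
    ext <;> simp [Ψ, LinearEquiv.conj_apply]
  have n2 : (2 : ℝ) ≠ 0 ∧ (2 : ℝ) ≠ 1 ∧ (2 : ℝ) ≠ -1 := by norm_num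
  have j1 : JoinedIn (cayleyDomain (planeSum (planeSum η'))) (hypSum 2 (hypSum 2 Z))
      (hypSum (1 / 2) (hypSum (1 / 2) Z')) :=
    (joinedIn_hypSum (joinedIn_hypSum hjZ n2.1 n2.2.1 n2.2.2) n2.1 n2.2.1 n2.2.2).trans
      (joinedIn_hypSum_hypSum hZc)
  have j2 := joinedIn_conj (isometry_symm hΨ) j1
  have j3 := joinedIn_hypSum hj' n2.1 n2.2.1 n2.2.2
  rw [hconj] at j3
  have j4 := joinedIn_conj (isometry_symm hφ) (j3.trans j2)
  refine ⟨_, ?_, hj.trans j4⟩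
  exact conj_mem_shrinkable (isometry_symm hφ) (conj_mem_shrinkable (isometry_symm hΨ)
    (hypSum_mem_shrinkable (hypSum_mem_shrinkable hZ' (by norm_num) (by norm_num)) (by norm_num)
      (by norm_num)))

/-- Elements of the Cayley domain with `det (1 - X) > 0` can be joined to shrinkable ones. -/
theorem exists_joinedIn_shrinkable (hAlt : ω.IsAlt) (hω : ω.Nondegenerate) {X : End ℝ H}
    (hX : X ∈ cayleyDomain ω) (hdet : 0 < LinearMap.det (1 - X)) :
    ∃ X' ∈ shrinkable ω, JoinedIn (cayleyDomain ω) X X' :=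
  exists_joinedIn_shrinkable_aux _ hAlt hω le_rfl hX hdet

end Induction

/-! ### Path components and the values of the invariants -/

section Components

attribute [local instance] endTopology end_isModuleTopology end_isTopologicalRing

variable {H : Type*} [AddCommGroup H] [Module ℝ H] {ω : LinearMap.BilinForm ℝ H}

theorem joinedIn_smul_of_shrinkable {X : End ℝ H} (hX : X ∈ shrinkable ω) {ε : ℝ} (h0 : 0 < ε)
    (h1 : ε ≤ 1) : JoinedIn (cayleyDomain ω) X (ε • X) := by
  refine JoinedIn.ofLine (f := fun t => (1 - t + t * ε) • X) ?_ (by simp) (by simp) ?_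
  · exact Continuous.continuousOn (by fun_prop)
  rintro _ ⟨t, ⟨ht0, ht1⟩, rfl⟩
  have hpos : 0 < 1 - t + t * ε := by
    rcases ht1.eq_or_lt with rfl | h
    · linarith
    · nlinarith [mul_nonneg ht0 h0.le]
  exact ⟨smul_mem_skewReg hX.1 hpos.ne', hX.2 _ hpos (by nlinarith)⟩

/-- The symplectic transvection `x ↦ x + c ω(x, u) u`. -/
def sympTransvection (ω : LinearMap.BilinForm ℝ H) (u : H) (c : ℝ) : End ℝ H :=
  1 + c • LinearMap.smulRight (ω.flip u) u

theorem sympTransvection_apply (u : H) (c : ℝ) (x : H) :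
    sympTransvection ω u c x = x + (c * ω x u) • u := by
  simp [sympTransvection, smul_smul]

theorem sympTransvection_comp (hAlt : ω.IsAlt) (u : H) (c : ℝ) :
    sympTransvection ω u c ∘ₗ sympTransvection ω u (-c) = LinearMap.id := by
  ext x
  simp only [LinearMap.comp_apply, sympTransvection_apply, map_add, map_smul, hAlt u,
    LinearMap.id_apply]
  simp

/-- The symplectic transvection as an equivalence. -/
def sympTransvectionEquiv (hAlt : ω.IsAlt) (u : H) (c : ℝ) : H ≃ₗ[ℝ] H :=
  LinearEquiv.ofLinearMap (sympTransvection ω u c) (sympTransvection ω u (-c))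
    (sympTransvection_comp hAlt u c)
    (by simpa using sympTransvection_comp hAlt u (-c))

theorem sympTransvection_isometry (hAlt : ω.IsAlt) (u : H) (c : ℝ) (x y : H) :
    ω (sympTransvectionEquiv hAlt u c x) (sympTransvectionEquiv hAlt u c y) = ω x y := by
  change ω (sympTransvection ω u c x) (sympTransvection ω u c y) = ω x y
  simp only [sympTransvection_apply, map_add, map_smul, LinearMap.add_apply, LinearMap.smul_apply,
    hAlt u, smul_eq_mul, ← hAlt.neg_eq y u]
  ring

variable [FiniteDimensional ℝ H]

/-- Injectivity along the path keeps `ω(X x, x)` nondegenerate, so the inertia of its hermitian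
extension is constant. -/
theorem sigPos_eq_of_joinedIn (hAlt : ω.IsAlt) (hω : ω.Nondegenerate) {X X' : End ℝ H}
    (h : JoinedIn (cayleyDomain ω) X X') :
    sigPos (skewQuad ω X) = sigPos (skewQuad ω X') := by
  obtain ⟨γ, hγ⟩ := h
  have hlc := isLocallyConstant_posInertia (b := fun t => sesqExt (ω.compLeft (γ t)))
    (fun t x y => by
      rw [conj_sesqExt (c := 1), Complex.ofReal_one, one_mul]
      intro x y
      change ω (γ t x) y = 1 * ω (γ t y) x
      rw [one_mul, (hγ t).1.1 x y, hAlt.neg_eq x])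
    (continuous_sesqExt fun x y => by
      let L : End ℝ H →ₗ[ℝ] ℝ := (ω.flip y) ∘ₗ LinearMap.applyₗ x
      exact (IsModuleTopology.continuous_of_linearMap L).comp γ.continuous)
    ⊤ (fun t x _ hx => by
      have h0 : conjC H x = 0 := baseChange_nondegenerate (B := ω.compLeft (γ t))
        (fun x hx => (hγ t).1.2 ((hω.1 _ hx).trans (map_zero _).symm)) fun y => hx y trivial
      rw [← conjC_conjC x, h0, map_zero])
  have h01 := hlc.apply_eq_of_preconnectedSpace 0 1
  simp only [γ.source, γ.target] at h01
  have hX := (hγ 0).1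
  have hX' := (hγ 1).1
  rw [γ.source] at hX
  rw [γ.target] at hX'
  rwa [posInertia_sesqExt (skewQuad_radical hAlt hω hX),
    posInertia_sesqExt (skewQuad_radical hAlt hω hX')] at h01

/-- For `det (1 - X) > 0`, the signature determines the path component. -/
theorem joinedIn_of_det_pos (hAlt : ω.IsAlt) (hω : ω.Nondegenerate) {X X' : End ℝ H}
    (hX : X ∈ cayleyDomain ω) (hX' : X' ∈ cayleyDomain ω) (hd : 0 < LinearMap.det (1 - X))
    (hd' : 0 < LinearMap.det (1 - X')) (h : sigPos (skewQuad ω X) = sigPos (skewQuad ω X')) :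
    JoinedIn (cayleyDomain ω) X X' := by
  obtain ⟨X₁, hX₁, hj⟩ := exists_joinedIn_shrinkable hAlt hω hX hd
  obtain ⟨X₂, hX₂, hj'⟩ := exists_joinedIn_shrinkable hAlt hω hX' hd'
  rw [sigPos_eq_of_joinedIn hAlt hω hj, sigPos_eq_of_joinedIn hAlt hω hj'] at h
  -- This path may acquire the eigenvalue `1`, but by compactness a single small factor `ε` makes `1
  -- - ε γ` invertible throughout; shrinkability joins the endpoints to their multiples by `ε`.
  obtain ⟨γ, hγ⟩ := joinedIn_skewReg hAlt hω hX₂.1 hX₁.1 h.symm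
  have hcont : Continuous fun p : ℝ × unitInterval => LinearMap.det (1 - p.1 • γ p.2) := by
    refine continuous_linearMap_det.comp ?_
    have : Continuous fun p : ℝ × unitInterval => γ p.2 := γ.continuous.comp continuous_snd
    fun_prop
  have hev : ∀ᶠ s in 𝓝 (0 : ℝ), ∀ t ∈ (Set.univ : Set unitInterval),
      LinearMap.det (1 - s • γ t) ≠ 0 := by
    refine isCompact_univ.eventually_forall_of_forall_eventually fun t _ => ?_
    exact hcont.continuousAt.eventually_ne (by simp)
  obtain ⟨δ, hδ, hball⟩ := Metric.eventually_nhds_iff.1 hev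
  obtain ⟨ε, hε0, hε⟩ := exists_between (lt_min hδ one_pos)
  have hεδ : ε < δ := hε.trans_le (min_le_left _ _)
  have hε1 : ε < 1 := hε.trans_le (min_le_right _ _)
  have hjoin : JoinedIn (cayleyDomain ω) (ε • X₁) (ε • X₂) := by
    refine ⟨γ.map (f := fun X => ε • X) (continuous_const_smul ε), fun t => ?_⟩
    refine ⟨smul_mem_skewReg (hγ t) hε0.ne', ?_⟩
    refine injective_iff_det_ne_zero.2 (hball ?_ t trivial)
    rw [Real.dist_eq, sub_zero, abs_of_pos hε0]
    exact hεδ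
  exact ((hj.trans (joinedIn_smul_of_shrinkable hX₁ hε0 hε1.le)).trans hjoin).trans
    ((hj'.trans (joinedIn_smul_of_shrinkable hX₂ hε0 hε1.le)).symm)

/-- Letting the coefficient run from `0` to `c` deforms the conjugation to the identity. -/
theorem joinedIn_conj_sympTransvection (hAlt : ω.IsAlt) (u : H) (c : ℝ) {X : End ℝ H}
    (hX : X ∈ cayleyDomain ω) :
    JoinedIn (cayleyDomain ω) X ((sympTransvectionEquiv hAlt u c).conj X) := by
  have hconj : ∀ c, (sympTransvectionEquiv hAlt u c).conj X =
      sympTransvection ω u c * X * sympTransvection ω u (-c) := fun c => rfl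
  refine JoinedIn.ofLine (f := fun t => (sympTransvectionEquiv hAlt u (t * c)).conj X) ?_ ?_
    (by simp) ?_
  · simp only [hconj, sympTransvection]
    exact Continuous.continuousOn (by fun_prop)
  · simp [hconj, sympTransvection]
  · rintro _ ⟨t, -, rfl⟩
    exact conj_mem_cayleyDomain (sympTransvection_isometry hAlt u _) hX

/-- The transvection along `e' - e` with coefficient `ω(e, e')⁻¹` sends `e` to `e'`. -/
theorem exists_joinedIn_eigenvector_of_ne (hAlt : ω.IsAlt) {e e' : H} (hee : ω e e' ≠ 0)
    {X : End ℝ H} (hX : X ∈ cayleyDomain ω) {μ : ℝ} (he : X e = μ • e) :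
    ∃ X', JoinedIn (cayleyDomain ω) X X' ∧ X' e' = μ • e' := by
  set φ := sympTransvectionEquiv hAlt (e' - e) (ω e e')⁻¹ with hφ
  refine ⟨φ.conj X, joinedIn_conj_sympTransvection hAlt _ _ hX, ?_⟩
  have h1 : φ e = e' := by
    change sympTransvection ω (e' - e) (ω e e')⁻¹ e = e'
    rw [sympTransvection_apply, map_sub, hAlt e, sub_zero, inv_mul_cancel₀ hee]
    simp
  rw [LinearEquiv.conj_apply_apply, ← h1, φ.symm_apply_apply, he, map_smul]

/-- Eigenvectors can be moved to any nonzero vector along paths in the Cayley domain. -/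
theorem exists_joinedIn_eigenvector (hAlt : ω.IsAlt) (hω : ω.Nondegenerate) {e e' : H} (h0 : e ≠ 0)
    (h0' : e' ≠ 0) {X : End ℝ H} (hX : X ∈ cayleyDomain ω) {μ : ℝ} (he : X e = μ • e) :
    ∃ X', JoinedIn (cayleyDomain ω) X X' ∧ X' e' = μ • e' := by
  -- When `ω(e, e')` may vanish, one passes through a vector `z` that pairs nontrivially with both.
  obtain ⟨z, hz, hz'⟩ : ∃ z, ω e z ≠ 0 ∧ ω z e' ≠ 0 := by
    obtain ⟨a, ha⟩ := exists_apply_eq_one hω h0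
    obtain ⟨b, hb⟩ := exists_apply_eq_one hω h0'
    have hb' : ω b e' = -1 := by rw [← hAlt.neg_eq e', hb]
    by_cases h1 : ω a e' = 0
    · by_cases h2 : ω e b = 0
      · exact ⟨a + b, by simp [ha, h2], by simp [h1, hb']⟩
      · exact ⟨b, h2, by simp [hb']⟩
    · exact ⟨a, by simp [ha], h1⟩
  obtain ⟨X₁, hj, hX₁⟩ := exists_joinedIn_eigenvector_of_ne hAlt hz hX he
  obtain ⟨X₂, hj', hX₂⟩ := exists_joinedIn_eigenvector_of_ne hAlt hz' hj.target_mem hX₁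
  exact ⟨X₂, hj.trans hj', hX₂⟩

/-- For `det (1 - X) < 0`, the signature determines the path component. -/
theorem joinedIn_of_det_neg (hAlt : ω.IsAlt) (hω : ω.Nondegenerate) {X X' : End ℝ H}
    (hX : X ∈ cayleyDomain ω) (hX' : X' ∈ cayleyDomain ω) (hd : LinearMap.det (1 - X) < 0)
    (hd' : LinearMap.det (1 - X') < 0) (h : sigPos (skewQuad ω X) = sigPos (skewQuad ω X')) :
    JoinedIn (cayleyDomain ω) X X' := by
  obtain ⟨t, ht0, ht1, ht⟩ := exists_not_injective_of_det_neg hd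
  obtain ⟨s, hs0, hs1, hs⟩ := exists_not_injective_of_det_neg hd'
  obtain ⟨e, he0, hXe⟩ := exists_eigenvector_of_not_injective ht0 ht
  obtain ⟨e', he0', hXe'⟩ := exists_eigenvector_of_not_injective hs0 hs
  -- With a common eigenvector both maps split along the same plane; their eigenvalues may differ,
  -- but both are then moved to `2`.
  obtain ⟨X₁, hj, hX₁⟩ := exists_joinedIn_eigenvector hAlt hω he0 he0' hX hXe
  obtain ⟨f, hf⟩ := exists_apply_eq_one hω he0'
  obtain ⟨W, η, φ, hη, hη', hφ, hφe, -⟩ := exists_planeSum_isometry hAlt hω hf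
  obtain ⟨Y, hY, hjY⟩ := exists_joinedIn_conj_hypSum hφ hφe hj.target_mem
    ((one_lt_inv₀ ht0).2 ht1) hX₁
  obtain ⟨Y', hY', hjY'⟩ := exists_joinedIn_conj_hypSum hφ hφe hX' ((one_lt_inv₀ hs0).2 hs1) hXe'
  have hjX := hj.trans hjY
  have key : ∀ {X : End ℝ H} {Y : End ℝ W}, Y ∈ cayleyDomain η → LinearMap.det (1 - X) < 0 →
      JoinedIn (cayleyDomain ω) X (φ.symm.conj (hypSum 2 Y)) → 0 < LinearMap.det (1 - Y) ∧
        sigPos (skewQuad ω X) = sigPos (skewQuad η Y) + 1 := by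
    intro X Y hY hd hj
    constructor
    · have := sign_det_of_joinedIn_conj_hypSum hj
      rw [sign_neg hd] at this
      exact sign_eq_one_iff.1 (neg_inj.1 this).symm
    · rw [sigPos_eq_of_joinedIn hAlt hω hj, sigPos_skewQuad_conj (isometry_symm hφ),
        sigPos_skewQuad_hypSum hη hη' hY.1 two_pos]
  obtain ⟨hYd, hYs⟩ := key hY hd hjX
  obtain ⟨hYd', hYs'⟩ := key hY' hd' hjY'
  have hjj := joinedIn_of_det_pos hη hη' hY hY' hYd hYd' (by omega)
  have n2 : (2 : ℝ) ≠ 0 ∧ (2 : ℝ) ≠ 1 ∧ (2 : ℝ) ≠ -1 := by norm_num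
  have := joinedIn_conj (isometry_symm hφ) (joinedIn_hypSum hjj n2.1 n2.2.1 n2.2.2)
  exact (hjX.trans this).trans hjY'.symm

/-- Every signature is realized with `det (1 - X) > 0`. -/
theorem exists_sigPos_eq_of_det_pos (hAlt : ω.IsAlt) (hω : ω.Nondegenerate) {p : ℕ}
    (hp : p ≤ finrank ℝ H) :
    ∃ X ∈ cayleyDomain ω, 0 < LinearMap.det (1 - X) ∧ sigPos (skewQuad ω X) = p := by
  let v := finBasis ℝ H
  let w : Fin (finrank ℝ H) → ℝ := fun i => if (i : ℕ) < p then 1 else -1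
  have hw : ∀ i, w i ≠ 0 := fun i => by simp only [w]; split_ifs <;> norm_num
  let B : LinearMap.BilinForm ℝ H :=
    ∑ i, w i • LinearMap.BilinForm.linMulLin (v.coord i) (v.coord i)
  have hB : ∀ x y, B x y = ∑ i, w i * (v.repr x i * v.repr y i) := fun x y => by
    simp [B, LinearMap.sum_apply]
  let X : End ℝ H := (ω.toDual hω).symm.toLinearMap ∘ₗ B
  have hX : ∀ x y, ω (X x) y = B x y := fun x y => by
    rw [← LinearMap.BilinForm.toDual_def hω]
    simp [X]
  have hmem : X ∈ skewReg ω := by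
    refine ⟨fun x y => ?_, ?_⟩
    · rw [hAlt.neg_eq x, hX, hX, hB, hB]
      exact Finset.sum_congr rfl fun i _ => by ring
    · rw [← LinearMap.ker_eq_bot, LinearMap.ker_eq_bot']
      intro x hx
      refine v.ext_elem fun i => ?_
      have h1 := hX x (v i)
      rw [hx, hB, Finset.sum_eq_single i] at h1
      · simp at h1
        simpa using h1.resolve_left (hw i)
      · intro j _ hj
        simp [hj.symm]
      · simp
  -- A small positive multiple of `X` has the same signature and determinant `det (1 - s X)` near
  -- `1`.
  have hev : ∀ᶠ s in 𝓝 (0 : ℝ), 0 < LinearMap.det (1 - s • X) := by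
    have hc : Continuous fun s : ℝ => LinearMap.det (1 - s • X) :=
      continuous_linearMap_det.comp (by fun_prop)
    exact hc.continuousAt.eventually (lt_mem_nhds (a := (0 : ℝ)) (by simp))
  obtain ⟨δ, hδ, hball⟩ := Metric.eventually_nhds_iff.1 hev
  have hdet : 0 < LinearMap.det (1 - (δ / 2) • X) := hball (by
    rw [Real.dist_eq, sub_zero, abs_of_pos (by positivity)]; linarith)
  have hδ2 : 0 < δ / 2 := by positivity
  refine ⟨(δ / 2) • X, ⟨smul_mem_skewReg hmem hδ2.ne', injective_iff_det_ne_zero.2 hdet.ne'⟩, hdet,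
    ?_⟩
  have he : QuadraticMap.Equivalent (skewQuad ω ((δ / 2) • X))
      (QuadraticMap.weightedSumSquares ℝ fun i => δ / 2 * w i) := by
    refine ⟨⟨v.equivFun, fun x => ?_⟩⟩
    change QuadraticMap.weightedSumSquares ℝ (fun i => δ / 2 * w i) (v.equivFun x) =
      ω ((δ / 2) • X x) x
    rw [map_smul, LinearMap.smul_apply, hX, hB, QuadraticMap.weightedSumSquares_apply, smul_eq_mul,
      Finset.mul_sum]
    exact Finset.sum_congr rfl fun i _ => by simp; ring
  rw [QuadraticForm.sigPos_of_equiv_weightedSumSquares he]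
  have hset : {i | 0 < δ / 2 * w i} = {i : Fin (finrank ℝ H) | (i : ℕ) < p} := by
    ext i
    simp only [Set.mem_ofPred_eq, mul_pos_iff_of_pos_left hδ2, w]
    split_ifs with h <;> simp [h]
  rw [hset, ← Nat.card_coe_set_eq, Nat.card_eq_fintype_card, Fintype.card_subtype]
  simp only [Set.mem_ofPred_eq]
  rw [Fin.card_filter_val_lt]
  exact min_eq_right hp

/-- Every signature with both indices positive is realized with `det (1 - X) < 0`. -/
theorem exists_sigPos_eq_of_det_neg (hAlt : ω.IsAlt) (hω : ω.Nondegenerate) {p : ℕ}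
    (hp : p + 2 ≤ finrank ℝ H) :
    ∃ X ∈ cayleyDomain ω, LinearMap.det (1 - X) < 0 ∧ sigPos (skewQuad ω X) = p + 1 := by
  have : Nontrivial H := Module.nontrivial_of_finrank_pos (R := ℝ) (by omega)
  obtain ⟨e, he⟩ := exists_ne (0 : H)
  obtain ⟨f, hf⟩ := exists_apply_eq_one hω he
  obtain ⟨W, η, φ, hη, hη', hφ, -, -⟩ := exists_planeSum_isometry hAlt hω hf
  have hd : finrank ℝ H = 2 + finrank ℝ W := by
    rw [φ.finrank_eq, finrank_prod, finrank_prod, finrank_self]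
  -- The hyperbolic plane adds one to each index and makes the determinant negative.
  obtain ⟨Y, hY, hYd, hYs⟩ := exists_sigPos_eq_of_det_pos hη hη' (p := p) (by omega)
  refine ⟨φ.symm.conj (hypSum 2 Y), conj_mem_cayleyDomain (isometry_symm hφ)
    (hypSum_mem hY (by norm_num) (by norm_num) (by norm_num)), ?_, ?_⟩
  · rw [det_one_sub_conj, det_one_sub_hypSum]
    linarith
  · rw [sigPos_skewQuad_conj (isometry_symm hφ), sigPos_skewQuad_hypSum hη hη' hY.1 two_pos, hYs]

/-- If `det (1 - X) < 0`, the quadratic form is indefinite. -/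
theorem sigPos_lt_and_sigNeg_lt_of_det_neg (hAlt : ω.IsAlt) {X : End ℝ H}
    (hd : LinearMap.det (1 - X) < 0) :
    sigPos (skewQuad ω X) < finrank ℝ H ∧ sigNeg (skewQuad ω X) < finrank ℝ H := by
  obtain ⟨t, ht0, -, ht⟩ := exists_not_injective_of_det_neg hd
  obtain ⟨e, he0, hXe⟩ := exists_eigenvector_of_not_injective ht0 ht
  -- An eigenvector is isotropic because `ω` is alternating, and an isotropic line excludes both
  -- kinds of definiteness.
  have hQ : ∀ x ∈ Submodule.span ℝ {e}, skewQuad ω X x = 0 := by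
    intro x hx
    obtain ⟨c, rfl⟩ := Submodule.mem_span_singleton.1 hx
    simp [skewQuad_apply, hXe, hAlt e]
  have h1 := QuadraticForm.sigPos_add_finrank_le_of_nonpos (Q := skewQuad ω X)
    (V := Submodule.span ℝ {e}) fun x hx => (hQ x hx).le
  have h2 := QuadraticForm.sigPos_add_finrank_le_of_nonpos (Q := -skewQuad ω X)
    (V := Submodule.span ℝ {e}) fun x hx => by simp [hQ x hx]
  rw [finrank_span_singleton he0] at h1 h2
  rw [sigPos_neg] at h2
  omega

end Components

/-! ### Descent to connected components and the final classification -/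

section Main

attribute [local instance] endTopology end_isModuleTopology end_isTopologicalRing

variable {H : Type*} [AddCommGroup H] [Module ℝ H] [FiniteDimensional ℝ H]
  {ω : LinearMap.BilinForm ℝ H}

/-- By invariance the radical is the kernel of `1 - A²`, which factors into `1 - A` and `1 + A`. -/
theorem symmForm_nondegenerate (hω : ω.Nondegenerate) {A : End ℝ H} (hA : A ∈ Sp ω)
    (h1 : (1 : ℝ) ∉ spectrum ℝ A) (h1' : (-1 : ℝ) ∉ spectrum ℝ A) {x : H}
    (hx : ∀ y, symmForm ω A x y = 0) : x = 0 := by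
  rw [notMem_spectrum_iff] at h1 h1'
  have hsurj := LinearMap.injective_iff_surjective.1 (injective_of_mem_Sp hω hA)
  have hAA : x - A (A x) = 0 := hω.1 _ fun y => by
    obtain ⟨z, rfl⟩ := hsurj y
    have := hx z
    rw [symmForm_apply] at this
    rw [map_sub, LinearMap.sub_apply, hA, this]
  have h2 : x + A x = 0 := h1 <| by
    rw [map_zero, ← hAA]
    simp only [one_smul, LinearMap.sub_apply, Module.End.one_apply, map_add]
    abel
  refine h1' ?_
  rw [map_zero, LinearMap.sub_apply, LinearMap.smul_apply, Module.End.one_apply, neg_one_smul,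
    ← neg_add', h2, neg_zero]

/-- The subspace `E` varies with `A`, and its dimension may jump; the signature on the fixed whole
space avoids this. -/
theorem isLocallyConstant_kreinIndex (hAlt : ω.IsAlt) (hω : ω.Nondegenerate) :
    IsLocallyConstant fun A : SpStarStar ω => kreinIndex ω A.1 := by
  have hcont : ∀ x y, Continuous fun A : SpStarStar ω => symmForm ω A.1 x y := fun x y => by
    let L : End ℝ H →ₗ[ℝ] ℝ := ω x ∘ₗ LinearMap.applyₗ y - ω.flip y ∘ₗ LinearMap.applyₗ x
    exact (IsModuleTopology.continuous_of_linearMap L).comp continuous_induced_dom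
  have hnd : ∀ (A : SpStarStar ω) (x : ℂ ⊗[ℝ] H),
      (∀ y, sesqExt (symmForm ω A.1) x y = 0) → x = 0 := fun A x hx => by
    have h0 : conjC H x = 0 := baseChange_nondegenerate
      (fun x => symmForm_nondegenerate hω A.2.1 A.2.2.1 A.2.2.2) hx
    rw [← conjC_conjC x, h0, map_zero]
  have hpos := isLocallyConstant_posInertia (b := fun A : SpStarStar ω => sesqExt (symmForm ω A.1))
    (fun A x y => by
      rw [conj_sesqExt (symmForm_swap hAlt A.1), Complex.ofReal_one, one_mul])
    (continuous_sesqExt hcont) ⊤ (fun A x _ hx => hnd A x fun y => hx y trivial)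
  have hneg := isLocallyConstant_posInertia
    (b := fun A : SpStarStar ω => sesqExt (-symmForm ω A.1))
    (fun A x y => by
      rw [sesqExt_neg, sesqExt_neg, map_neg, conj_sesqExt (symmForm_swap hAlt A.1),
        Complex.ofReal_one, one_mul])
    (continuous_sesqExt fun x y => (hcont x y).neg) ⊤
    (fun A x _ hx => hnd A x fun y => by simpa only [sesqExt_neg, neg_eq_zero] using hx y trivial)
  simp only [sesqExt_neg] at hneg
  convert (hpos.prodMk hneg).comp fun p : ℕ × ℕ => ((p.1 : ℤ) - p.2) / 2 using 1
  funext A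
  have := two_mul_kreinIndex hAlt hω A.2.1 A.2.2.1 A.2.2.2
  simp only [Function.comp_apply]
  omega

theorem det_one_sub_ne_zero (A : SpStarStar ω) : LinearMap.det (1 - A.1) ≠ 0 := by
  have := A.2.2.1
  rwa [notMem_spectrum_iff, one_smul, injective_iff_det_ne_zero] at this

theorem continuous_sign_det_kreinIndex (hAlt : ω.IsAlt) (hω : ω.Nondegenerate) :
    Continuous fun A : SpStarStar ω =>
      (SignType.sign (LinearMap.det (1 - A.1)), kreinIndex ω A.1) := by
  refine .prodMk (continuous_iff_continuousAt.2 fun A => ?_)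
    (isLocallyConstant_kreinIndex hAlt hω).continuous
  have h : Continuous fun A : SpStarStar ω => LinearMap.det (1 - A.1) :=
    continuous_linearMap_det.comp (continuous_const.sub continuous_induced_dom)
  exact ContinuousAt.comp (g := SignType.sign)
    (continuousAt_sign_of_ne_zero (det_one_sub_ne_zero A)) h.continuousAt

/-- The Cayley transform as a map onto `SpStarStar ω`. -/
noncomputable def toSpStarStar (X : cayleyDomain ω) : SpStarStar ω :=
  ⟨cayley X.1, cayley_mem X.2⟩

theorem continuous_toSpStarStar : Continuous (toSpStarStar : cayleyDomain ω → SpStarStar ω) :=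
  continuous_induced_rng.2 (continuousOn_cayley ω).domRestrict

theorem toSpStarStar_surjective : Function.Surjective (toSpStarStar (ω := ω)) := fun A =>
  ⟨⟨cayley A.1, cayley_mem_cayleyDomain A.2.1 A.2.2.1 A.2.2.2⟩, Subtype.ext <| cayley_cayley <| by
    have := A.2.2.1
    rwa [notMem_spectrum_iff, one_smul] at this⟩

theorem sign_det_one_sub_toSpStarStar (X : cayleyDomain ω) :
    SignType.sign (LinearMap.det (1 - (toSpStarStar X).1)) =
      SignType.sign (LinearMap.det (1 - X.1)) :=
  sign_det_one_sub_cayley X.2.2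

theorem kreinIndex_toSpStarStar (hAlt : ω.IsAlt) (hω : ω.Nondegenerate) {n : ℕ}
    (hn : finrank ℝ H = 2 * n) (X : cayleyDomain ω) :
    kreinIndex ω (toSpStarStar X).1 = (sigPos (skewQuad ω X.1) : ℤ) - n := by
  have h : 2 * kreinIndex ω (toSpStarStar X).1 =
      (sigPos (skewQuad ω X.1) : ℤ) - sigNeg (skewQuad ω X.1) :=
    two_mul_kreinIndex_cayley hAlt hω X.2
  have h' := sigPos_add_sigNeg_skewQuad hAlt hω X.2.1
  omega

theorem connectedComponents_mk_eq_of_joinedIn {X X' : cayleyDomain ω}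
    (h : JoinedIn (cayleyDomain ω) X.1 X'.1) :
    ConnectedComponents.mk (toSpStarStar X) = ConnectedComponents.mk (toSpStarStar X') :=
  ConnectedComponents.coe_eq_coe'.2 <| pathComponent_subset_component _
    (h.joined_subtype.map continuous_toSpStarStar).symm

end Main

theorem lemma4p3 {H : Type*} [AddCommGroup H] [Module ℝ H] [FiniteDimensional ℝ H]
    (ω : LinearMap.BilinForm ℝ H) (hAlt : ω.IsAlt) (hNondeg : ω.Nondegenerate)
    (n : ℕ) (hn : Module.finrank ℝ H = 2 * n) :
    ∃ f : ConnectedComponents (SpStarStar ω) → SignType × ℤ,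
      (∀ A : SpStarStar ω,
        f (ConnectedComponents.mk A) =
          (SignType.sign (LinearMap.det (1 - A.1)), kreinIndex ω A.1)) ∧
      Function.Injective f ∧
      Set.range f =
        {p : SignType × ℤ | (p.1 = 1 ∧ |p.2| ≤ (n : ℤ)) ∨ (p.1 = -1 ∧ |p.2| ≤ (n : ℤ) - 1)} := by
  let f := (continuous_sign_det_kreinIndex hAlt hNondeg).connectedComponentsLift
  have hf : ∀ X : cayleyDomain ω, f (ConnectedComponents.mk (toSpStarStar X)) =
      (SignType.sign (LinearMap.det (1 - X.1)), (sigPos (skewQuad ω X.1) : ℤ) - n) := fun X => by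
    rw [← sign_det_one_sub_toSpStarStar, ← kreinIndex_toSpStarStar hAlt hNondeg hn]
    rfl
  have hsurj := ConnectedComponents.surjective_coe.comp (toSpStarStar_surjective (ω := ω))
  refine ⟨f, fun A => rfl, fun c c' h => ?_, ?_⟩
  · obtain ⟨X, rfl⟩ := hsurj c
    obtain ⟨X', rfl⟩ := hsurj c'
    have h : f (ConnectedComponents.mk (toSpStarStar X)) =
      f (ConnectedComponents.mk (toSpStarStar X')) := h
    rw [hf, hf, Prod.mk.injEq] at h
    obtain ⟨hs, hk⟩ := h
    have hsig : sigPos (skewQuad ω X.1) = sigPos (skewQuad ω X'.1) := by omega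
    refine connectedComponents_mk_eq_of_joinedIn ?_
    rcases (injective_iff_det_ne_zero.1 X.2.2).lt_or_gt with hd | hd
    · rw [sign_neg hd, eq_comm, sign_eq_neg_one_iff] at hs
      exact joinedIn_of_det_neg hAlt hNondeg X.2 X'.2 hd hs hsig
    · rw [sign_pos hd, eq_comm, sign_eq_one_iff] at hs
      exact joinedIn_of_det_pos hAlt hNondeg X.2 X'.2 hd hs hsig
  · ext ⟨s, k⟩
    constructor
    · rintro ⟨c, hc⟩
      obtain ⟨X, rfl⟩ := hsurj c
      obtain ⟨rfl, rfl⟩ := Prod.mk.inj ((hf X).symm.trans hc)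
      have hsum := sigPos_add_sigNeg_skewQuad hAlt hNondeg X.2.1
      rcases (injective_iff_det_ne_zero.1 X.2.2).lt_or_gt with hd | hd
      · obtain ⟨h₁, h₂⟩ := sigPos_lt_and_sigNeg_lt_of_det_neg hAlt hd
        exact Or.inr ⟨sign_neg hd, abs_le.2 ⟨by omega, by omega⟩⟩
      · exact Or.inl ⟨sign_pos hd, abs_le.2 ⟨by omega, by omega⟩⟩
    · rintro (⟨h, hk⟩ | ⟨h, hk⟩) <;> obtain rfl : s = _ := h <;>
        obtain ⟨h₁, h₂⟩ := abs_le.1 hk <;> dsimp only at h₁ h₂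
      · obtain ⟨X, hX, hd, hs⟩ := exists_sigPos_eq_of_det_pos hAlt hNondeg
          (p := (n + k).toNat) (by omega)
        refine ⟨ConnectedComponents.mk (toSpStarStar ⟨X, hX⟩), (hf _).trans ?_⟩
        rw [hs, sign_pos hd]
        exact Prod.ext rfl (by dsimp only; omega)
      -- The positive index must be `n + k` and the lemma yields `p + 1`; `|k| ≤ n - 1` gives both
      -- `n + k - 1 ≥ 0` and `p + 2 ≤ 2n`.
      · obtain ⟨X, hX, hd, hs⟩ := exists_sigPos_eq_of_det_neg hAlt hNondeg
          (p := (n + k - 1).toNat) (by omega)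
        refine ⟨ConnectedComponents.mk (toSpStarStar ⟨X, hX⟩), (hf _).trans ?_⟩
        rw [hs, sign_neg hd]
        exact Prod.ext rfl (by dsimp only; omega)
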